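/- For a positive integer $m$ write $e_m(z)=e^{2\pi i z/m}$, and for an integer $x$ coprime to $m$ let $x^*$ denote its multiplicative inverse modulo $m$. For every $\varepsilon>0$ there is $\delta=\delta(\varepsilon)>0$ such that the following holds. Let $m\ge 2$ be an integer and let $N_1,N_2\ge m^{\varepsilon}$ be integers such that, for $i=1$ or $i=2$, $$N_i\notin\bigcup_{j\ge 1}\left[m^{\frac1{2j}-\varepsilon},\,m^{\frac1{2j}+\varepsilon}\right].$$ Then for all complex numbers $\alpha_1(x)$ $(1\le x\le N_1)$ and $\alpha_2(x)$ $(1\le x\le N_2)$ of absolute value at most $1$, $$\max_{(a,m)=1}\left|\sum_{\substack{x_1=1\\ (x_1,m)=1}}^{N_1}\ \sum_{\substack{x_2=1\\ (x_2,m)=1}}^{N_2}\alpha_1(x_1)\,\alpha_2(x_2)\,e_m(a x_1^*x_2^*)\right|<m^{-\delta}N_1N_2 .$$ -/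

import Mathlib

noncomputable section

/-- The additive character `e_m(z) = exp(2 π i z / m)` at an integer `z`. -/
def eMod (m : ℕ) (z : ℤ) : ℂ :=
  Complex.exp (2 * Real.pi * Complex.I * (z : ℂ) / (m : ℂ))

/-- `x^*`: the representative in `[0, m - 1]` of the multiplicative inverse of `x` modulo `m`
(only used when `x` is coprime to `m`). -/
def recip (m : ℕ) (x : ℕ) : ℤ :=
  (((x : ZMod m)⁻¹).val : ℤ)

/-- The bilinear Kloosterman sum over `[1, N₁] × [1, N₂]`; both variables of summation are
restricted to integers coprime to `m`. -/
def bilinearKloosterman (m : ℕ) (a : ℤ) (α₁ α₂ : ℕ → ℂ) (N₁ N₂ : ℕ) : ℂ :=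
  ∑ x₁ ∈ (Finset.Icc 1 N₁).filter (fun x => Nat.Coprime x m),
    ∑ x₂ ∈ (Finset.Icc 1 N₂).filter (fun x => Nat.Coprime x m),
      α₁ x₁ * α₂ x₂ * eMod m (a * recip m x₁ * recip m x₂)

/-- The union over `j ≥ 1` of the windows `[m^(1/(2j) - ε), m^(1/(2j) + ε)]`. -/
def criticalWindows (m : ℕ) (ε : ℝ) : Set ℝ :=
  ⋃ j : ℕ, ⋃ _ : 1 ≤ j,
    Set.Icc ((m : ℝ) ^ (1 / (2 * (j : ℝ)) - ε)) ((m : ℝ) ^ (1 / (2 * (j : ℝ)) + ε))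

end

/-! Let `J_k(A)` be the number of solutions of `x₁* + ⋯ + x_k* ≡ y₁* + ⋯ + y_k*` mod `m` with
entries in `A`. Two applications of Hölder, Cauchy-Schwarz and Parseval on `ZMod m` bound the `2 k₁
k₂`-th power of the bilinear sum by its trivial bound with `N₁ ^ (2k₁) N₂ ^ (2k₂)` replaced by `m
J_{k₁} J_{k₂}` (`norm_bilinear_pow_le`). So it suffices that both `J_k` are about `N ^ (2k) / m ^
(1/2)` or smaller, one of them with a power to spare.

Over `ℚ` the same equation has `≪ N ^ (k + η)` solutions, because the product of all denominators is
powerful (`exists_energy_inv_le`). Sums of reciprocals that agree mod `m` but differ in `ℚ` are at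
least `m / N ^ (2k)` apart. After dropping `x ≤ N m ^ (-η)` they lie in `[0, k m ^ η / N]`, so each
residue class contains few rational values (`energy_zmod_inv_le`). Hence `J_k ≪ N ^ (3k-1) / m + N ^
k` up to small powers, which is good enough for `m ^ (1/(2k)) ≤ N ≤ m ^ (1/(2(k-1)))`. These ranges
cover all `N ≥ m ^ ε` with bounded `k`, and away from their endpoints, the centres of the critical
windows, a power of `m` is saved.

The constant is absorbed for large `m`. The finitely many remaining `m` still allow arbitrarily
large `N₁`, `N₂`. There, residues `1, 2` mod `m` give `2 × 2` blocks whose phases cannot all align,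
and these fill a positive proportion of the sum
(`exists_norm_bilinearKloosterman_le_of_fixed_modulus`). -/

open Finset

/-! ### The divisor bound. -/

/-- The local factor in the divisor bound. -/
lemma add_one_le_mul_rpow {η : ℝ} (hη : 0 < η) (a : ℕ) :
    (a : ℝ) + 1 ≤ (1 + 1 / (η * Real.log 2)) * (2 : ℝ) ^ ((a : ℝ) * η) := by
  have hl : 0 < Real.log 2 := Real.log_pos (by norm_num)
  have h1 : (a : ℝ) * η * Real.log 2 + 1 ≤ (2 : ℝ) ^ ((a : ℝ) * η) := by
    rw [Real.rpow_def_of_pos (by norm_num)]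
    have := Real.add_one_le_exp (Real.log 2 * (a * η))
    linarith
  have h2 : 0 < η * Real.log 2 := by positivity
  calc (a : ℝ) + 1 ≤ (1 + 1 / (η * Real.log 2)) * ((a : ℝ) * η * Real.log 2 + 1) := by
        have : (1 + 1 / (η * Real.log 2)) * ((a : ℝ) * η * Real.log 2 + 1)
            = a + 1 + a * (η * Real.log 2) + 1 / (η * Real.log 2) := by
          field_simp
          ring
        rw [this]
        have : 0 ≤ a * (η * Real.log 2) := by positivity
        have : 0 ≤ 1 / (η * Real.log 2) := by positivity
        linarith
    _ ≤ _ := by gcongr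

/-- The divisor bound `d(n) ≪ n ^ η`. -/
theorem exists_card_divisors_le {η : ℝ} (hη : 0 < η) :
    ∃ C : ℝ, 1 ≤ C ∧ ∀ n : ℕ, n ≠ 0 → (#n.divisors : ℝ) ≤ C * (n : ℝ) ^ η := by
  have hl : 0 < Real.log 2 := Real.log_pos (by norm_num)
  set c : ℝ := 1 + 1 / (η * Real.log 2) with hc
  have hc1 : 1 ≤ c := by
    have : 0 ≤ 1 / (η * Real.log 2) := by positivity
    linarith
  -- From this threshold on `p ^ η ≥ 2`, so `a + 1 ≤ 2 ^ a ≤ p ^ (a η)` costs no constant; only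
  -- primes below `P` contribute a factor `c`.
  set P : ℕ := ⌈(2 : ℝ) ^ (1 / η)⌉₊ with hP
  refine ⟨c ^ P, one_le_pow₀ hc1, fun n hn => ?_⟩
  have hfac : (n : ℝ) ^ η
      = ∏ p ∈ n.primeFactors, (p : ℝ) ^ ((n.factorization p : ℝ) * η) := by
    conv_lhs => rw [← Nat.prod_factorization_pow_eq_self hn]
    rw [Finsupp.prod, Nat.support_factorization]
    push_cast
    rw [← Real.finsetProd_rpow _ _ (fun i _ => by positivity)]
    refine prod_congr rfl fun p _ => ?_
    rw [← Real.rpow_natCast, ← Real.rpow_mul (by positivity)]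
  have hloc : ∀ p ∈ n.primeFactors, ((n.factorization p : ℝ) + 1)
      ≤ (if p < P then c else 1) * (p : ℝ) ^ ((n.factorization p : ℝ) * η) := by
    intro p hp
    have hp2 : (2 : ℝ) ≤ p := by exact_mod_cast (Nat.prime_of_mem_primeFactors hp).two_le
    split_ifs with h
    · refine (add_one_le_mul_rpow hη _).trans ?_
      gcongr
    · have h1 : (2 : ℝ) ^ (1 / η) ≤ p := (Nat.le_ceil _).trans (by exact_mod_cast not_lt.mp h)
      have h2 : (2 : ℝ) ≤ (p : ℝ) ^ η := by
        calc (2 : ℝ) = ((2 : ℝ) ^ (1 / η)) ^ η := by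
              rw [← Real.rpow_mul (by norm_num), one_div_mul_cancel hη.ne', Real.rpow_one]
          _ ≤ _ := by gcongr
      rw [one_mul, mul_comm, Real.rpow_mul (by positivity), Real.rpow_natCast]
      calc ((n.factorization p : ℝ) + 1) ≤ 2 ^ (n.factorization p) := by
            exact_mod_cast Nat.lt_two_pow_self
        _ ≤ _ := by gcongr
  rw [Nat.card_divisors hn]
  push_cast
  calc ∏ p ∈ n.primeFactors, ((n.factorization p : ℝ) + 1)
      ≤ ∏ p ∈ n.primeFactors,
          (if p < P then c else 1) * (p : ℝ) ^ ((n.factorization p : ℝ) * η) :=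
        prod_le_prod (fun _ _ => by positivity) hloc
    _ = (∏ p ∈ n.primeFactors, if p < P then c else 1) * (n : ℝ) ^ η := by
        rw [prod_mul_distrib, hfac]
    _ ≤ c ^ P * (n : ℝ) ^ η := by
        gcongr
        rw [← prod_filter, prod_const]
        refine pow_le_pow_right₀ hc1 ?_
        calc #{p ∈ n.primeFactors | p < P} ≤ #(range P) :=
              card_le_card fun p hp => by simpa using (mem_filter.mp hp).2
          _ = P := card_range P

/-! ### Unit fractions and powerful numbers. -/

/-- In a vanishing signed sum of unit fractions every prime dividing the product of the
denominators divides it at least twice. -/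
lemma sq_dvd_prod_of_sum_div_eq_zero {ι : Type*} [Fintype ι] [DecidableEq ι] (z : ι → ℕ)
    (σ : ι → ℤ) (hz : ∀ i, z i ≠ 0) (hσ : ∀ i, IsUnit (σ i))
    (h : ∑ i, (σ i : ℚ) / z i = 0) {p : ℕ} (hp : p.Prime) (hdvd : p ∣ ∏ i, z i) :
    p ^ 2 ∣ ∏ i, z i := by
  obtain ⟨i, -, hi⟩ := (Nat.Prime.prime hp).exists_mem_finset_dvd hdvd
  rw [← mul_prod_erase univ z (mem_univ i), sq]
  refine mul_dvd_mul hi ?_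
  by_cases hj : ∃ j ∈ univ.erase i, p ∣ z j
  · obtain ⟨j, hj, hpj⟩ := hj
    exact hpj.trans (dvd_prod_of_mem z hj)
  -- After clearing denominators every term but the `i`-th keeps the factor `z i`, so `p` divides
  -- the `i`-th term, which is a sign times the product of the other `z l`.
  have hcleared : ∑ j, σ j * (∏ l ∈ univ.erase j, (z l : ℤ)) = 0 := by
    have h2 : (∏ l, (z l : ℚ)) * ∑ j, (σ j : ℚ) / z j = 0 := by rw [h, mul_zero]
    rw [mul_sum] at h2
    have h3 : ∀ j, (∏ l, (z l : ℚ)) * ((σ j : ℚ) / z j)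
        = ((σ j * (∏ l ∈ univ.erase j, (z l : ℤ)) : ℤ) : ℚ) := by
      intro j
      have : (z j : ℚ) ≠ 0 := by exact_mod_cast hz j
      rw [← mul_prod_erase univ (fun l => (z l : ℚ)) (mem_univ j)]
      push_cast
      field_simp
    simp_rw [h3] at h2
    exact_mod_cast h2
  rw [← add_sum_erase univ _ (mem_univ i)] at hcleared
  have hrest : (p : ℤ) ∣ ∑ j ∈ univ.erase i, σ j * (∏ l ∈ univ.erase j, (z l : ℤ)) := by
    refine dvd_sum fun j hj' => Dvd.dvd.mul_left ?_ _
    have : (z i : ℤ) ∣ ∏ l ∈ univ.erase j, (z l : ℤ) :=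
      dvd_prod_of_mem (fun l => (z l : ℤ)) (by
        simp only [mem_erase, mem_univ, and_true] at hj' ⊢
        exact fun h => hj' h.symm)
    exact (Int.natCast_dvd_natCast.mpr hi).trans this
  have hmain : (p : ℤ) ∣ σ i * ∏ l ∈ univ.erase i, (z l : ℤ) :=
    (dvd_add_left hrest).mp (hcleared ▸ dvd_zero _)
  rw [IsUnit.dvd_mul_left (hσ i)] at hmain
  exact_mod_cast hmain

/-- A powerful number is of the form `a * b ^ 2` with `a ∣ b`. -/
lemma exists_eq_mul_sq_of_powerful {n : ℕ}
    (h : ∀ p : ℕ, p.Prime → p ∣ n → p ^ 2 ∣ n) :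
    ∃ a b : ℕ, a ∣ b ∧ n = a * b ^ 2 := by
  obtain ⟨a, b, hab, hsq⟩ := Nat.sq_mul_squarefree n
  refine ⟨a, b, ?_, by rw [← hab, mul_comm]⟩
  rw [← Nat.prod_primeFactors_of_squarefree hsq]
  refine prod_primes_dvd b (fun p hp => (Nat.prime_of_mem_primeFactors hp).prime) fun p hp => ?_
  have hp' := Nat.prime_of_mem_primeFactors hp
  have hpn : p ∣ n := hab ▸ (Nat.dvd_of_mem_primeFactors hp).mul_left _
  -- The squarefree `a` contains `p` only once, so the other factor `p` comes from `b ^ 2`.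
  have h2 : p * p ∣ a * b ^ 2 := by
    rw [← sq, mul_comm a, hab]
    exact h p hp' hpn
  exact hp'.dvd_of_dvd_pow (Squarefree.dvd_of_squarefree_of_mul_dvd_mul_right hsq h2)

/-! ### Additive energies. -/

/-- The `k`-tuples with entries in `A`. -/
def tuples (k : ℕ) (A : Finset ℕ) : Finset (Fin k → ℕ) :=
  Fintype.piFinset fun _ => A

lemma mem_tuples {k : ℕ} {A : Finset ℕ} {x : Fin k → ℕ} : x ∈ tuples k A ↔ ∀ i, x i ∈ A :=
  Fintype.mem_piFinset

/-- The number of representations of `s` as a sum of `k` values of `f` on `A`. -/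
def repCount {G : Type*} [AddCommMonoid G] [DecidableEq G] (k : ℕ) (A : Finset ℕ) (f : ℕ → G)
    (s : G) : ℕ :=
  #{x ∈ tuples k A | ∑ i, f (x i) = s}

/-- The number of solutions of `f x₁ + ⋯ + f x_k = f y₁ + ⋯ + f y_k` in `A`. -/
def energy {G : Type*} [AddCommMonoid G] [DecidableEq G] (k : ℕ) (A : Finset ℕ) (f : ℕ → G) : ℕ :=
  #{p ∈ tuples k A ×ˢ tuples k A | ∑ i, f (p.1 i) = ∑ i, f (p.2 i)}

section energy

variable {G : Type*} [AddCommMonoid G] [DecidableEq G]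

lemma energy_eq_sum_sq (k : ℕ) (A : Finset ℕ) (f : ℕ → G) (T : Finset G)
    (hT : ∀ x ∈ tuples k A, ∑ i, f (x i) ∈ T) :
    energy k A f = ∑ s ∈ T, repCount k A f s ^ 2 := by
  rw [energy, card_eq_sum_card_fiberwise (f := fun p => ∑ i, f (p.1 i)) (t := T)]
  · refine sum_congr rfl fun s _ => ?_
    rw [sq, repCount, ← card_product]
    congr 1
    ext p
    simp only [mem_filter, mem_product]
    constructor
    · rintro ⟨⟨⟨h1, h2⟩, h3⟩, h4⟩
      exact ⟨⟨h1, h4⟩, h2, h3 ▸ h4⟩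
    · rintro ⟨⟨h1, h4⟩, h2, h3⟩
      exact ⟨⟨⟨h1, h2⟩, h4.trans h3.symm⟩, h4⟩
  · intro p hp
    simp only [coe_filter, mem_product, Set.mem_ofPred_eq] at hp
    exact hT _ hp.1.1

lemma energy_mono (k : ℕ) {A B : Finset ℕ} (h : A ⊆ B) (f : ℕ → G) :
    energy k A f ≤ energy k B f := by
  refine card_le_card fun p hp => ?_
  simp only [mem_filter, mem_product, mem_tuples] at hp ⊢
  exact ⟨⟨fun i => h (hp.1.1 i), fun i => h (hp.1.2 i)⟩, hp.2⟩

/-- Only diagonal solutions exist for `k = 1`. This case must be free of a loss `N ^ η`, since there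
`N` is not bounded by a power of `m`. -/
lemma energy_one_le_card {A : Finset ℕ} {f : ℕ → G} (hf : Set.InjOn f A) :
    energy 1 A f ≤ #A := by
  refine card_le_card_of_injOn (fun p => p.1 0) (fun p hp => ?_) ?_
  · simp only [coe_filter, mem_product, mem_tuples, Set.mem_ofPred_eq] at hp
    exact hp.1.1 0
  · intro p hp q hq hpq
    simp only [coe_filter, mem_product, mem_tuples, Set.mem_ofPred_eq, Fin.sum_univ_one] at hp hq
    have h1 : p.1 0 = p.2 0 := hf (hp.1.1 0) (hp.1.2 0) hp.2
    have h2 : q.1 0 = q.2 0 := hf (hq.1.1 0) (hq.1.2 0) hq.2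
    simp only at hpq
    refine Prod.ext (funext fun i => ?_) (funext fun i => ?_) <;>
      rw [Subsingleton.elim i 0]
    · exact hpq
    · rw [← h1, ← h2, hpq]

end energy

/-! ### Counting solutions over the rationals. -/

/-- The product of all the entries in a solution of an equation between sums of unit fractions
is powerful. -/
lemma prod_mul_prod_powerful {k : ℕ} (x y : Fin k → ℕ) (hx : ∀ i, x i ≠ 0) (hy : ∀ i, y i ≠ 0)
    (h : ∑ i, (x i : ℚ)⁻¹ = ∑ i, (y i : ℚ)⁻¹) {p : ℕ} (hp : p.Prime)
    (hdvd : p ∣ (∏ i, x i) * ∏ i, y i) : p ^ 2 ∣ (∏ i, x i) * ∏ i, y i := by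
  have := sq_dvd_prod_of_sum_div_eq_zero (ι := Fin k ⊕ Fin k) (Sum.elim x y)
    (Sum.elim (fun _ => 1) fun _ => -1) (by rintro (i | i) <;> simp [hx, hy])
    (by rintro (i | i) <;> simp) (by simp [h, neg_div]) hp
  simp only [Fintype.prod_sum_type, Sum.elim_inl, Sum.elim_inr] at this
  exact this hdvd

/-- The product of all entries is powerful, hence equal to `a * b ^ 2` with `a ∣ b`, and every entry
divides it. As the product is at most `N ^ (2k)`, there are only `N ^ k` choices of `b`; all other
choices are divisors. -/
lemma energy_inv_subset (k N : ℕ) :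
    {p ∈ tuples k (Icc 1 N) ×ˢ tuples k (Icc 1 N) |
        ∑ i, (p.1 i : ℚ)⁻¹ = ∑ i, (p.2 i : ℚ)⁻¹} ⊆
      (Icc 1 (N ^ k)).biUnion fun b => b.divisors.biUnion fun a =>
        tuples k (a * b ^ 2).divisors ×ˢ tuples k (a * b ^ 2).divisors := by
  rintro ⟨x, y⟩ hp
  simp only [mem_filter, mem_product, mem_tuples, mem_Icc] at hp
  obtain ⟨⟨hx, hy⟩, hxy⟩ := hp
  have hx0 : ∀ i, x i ≠ 0 := fun i => by have := (hx i).1; omega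
  have hy0 : ∀ i, y i ≠ 0 := fun i => by have := (hy i).1; omega
  have hn : (∏ i, x i) * ∏ i, y i ≠ 0 :=
    mul_ne_zero (prod_ne_zero_iff.mpr fun i _ => hx0 i) (prod_ne_zero_iff.mpr fun i _ => hy0 i)
  obtain ⟨a, b, hab, hnab⟩ := exists_eq_mul_sq_of_powerful
    fun p hp h => prod_mul_prod_powerful x y hx0 hy0 hxy hp h
  have ha : a ≠ 0 := by rintro rfl; simp at hnab; exact hn (by simpa using hnab)
  have hb : b ≠ 0 := by rintro rfl; simp at hnab; exact hn (by simpa using hnab)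
  have hle : ∀ z : Fin k → ℕ, (∀ i, 1 ≤ z i ∧ z i ≤ N) → ∏ i, z i ≤ N ^ k := fun z hz => by
    simpa using prod_le_pow_card univ z N fun i _ => (hz i).2
  have hbN : b ≤ N ^ k := by
    refine le_of_pow_le_pow_left₀ two_ne_zero (Nat.zero_le _) ?_
    calc b ^ 2 ≤ a * b ^ 2 := Nat.le_mul_of_pos_left _ (Nat.pos_of_ne_zero ha)
      _ ≤ N ^ k * N ^ k := by rw [← hnab]; exact Nat.mul_le_mul (hle x hx) (hle y hy)
      _ = (N ^ k) ^ 2 := (sq _).symm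
  simp only [mem_biUnion, mem_product, mem_tuples, mem_Icc, Nat.mem_divisors]
  refine ⟨b, ⟨Nat.pos_of_ne_zero hb, hbN⟩, a, ⟨hab, hb⟩, fun i => ?_, fun i => ?_⟩
  · exact ⟨hnab ▸ (dvd_prod_of_mem x (mem_univ i)).mul_right _, hnab ▸ hn⟩
  · exact ⟨hnab ▸ (dvd_prod_of_mem y (mem_univ i)).mul_left _, hnab ▸ hn⟩

/-- The number of solutions of `1/x₁ + ⋯ + 1/x_k = 1/y₁ + ⋯ + 1/y_k` in `[1, N]` is
`≪ N ^ (k + η)`. -/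
theorem exists_energy_inv_le {k : ℕ} (hk : 1 ≤ k) {η : ℝ} (hη : 0 < η) :
    ∃ C : ℝ, 1 ≤ C ∧ ∀ N : ℕ, 1 ≤ N →
      (energy k (Icc 1 N) (fun x => (x : ℚ)⁻¹) : ℝ) ≤ C * (N : ℝ) ^ k * (N : ℝ) ^ η := by
  have hk0 : (0 : ℝ) < k := by exact_mod_cast hk
  -- The divisor bound is used `2k + 1` times, for `a` and the `2k` entries, on integers up to `N ^
  -- (3k)`; the total loss is `N ^ η`.
  obtain ⟨C, hC1, hC⟩ := exists_card_divisors_le (η := η / (3 * k * (2 * k + 1))) (by positivity)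
  set θ := η / (3 * k * (2 * k + 1)) with hθ
  refine ⟨C ^ (2 * k + 1), one_le_pow₀ hC1, fun N hN => ?_⟩
  have hN1 : (1 : ℝ) ≤ N := by exact_mod_cast hN
  set D : ℝ := C * ((N : ℝ) ^ (3 * k)) ^ θ with hD
  have hD0 : 0 ≤ D := by positivity
  have hdiv : ∀ n : ℕ, n ≠ 0 → n ≤ N ^ (3 * k) → (#n.divisors : ℝ) ≤ D := fun n hn hnN => by
    refine (hC n hn).trans ?_
    have : (n : ℝ) ≤ (N : ℝ) ^ (3 * k) := by exact_mod_cast hnN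
    rw [hD]
    gcongr
  have hb : ∀ b ∈ Icc 1 (N ^ k), (∑ a ∈ b.divisors,
      (#(tuples k (a * b ^ 2).divisors ×ˢ tuples k (a * b ^ 2).divisors) : ℝ))
        ≤ D ^ (2 * k + 1) := by
    intro b hb
    rw [mem_Icc] at hb
    have h1 : ∀ a ∈ b.divisors, (#(tuples k (a * b ^ 2).divisors ×ˢ
        tuples k (a * b ^ 2).divisors) : ℝ) ≤ D ^ (2 * k) := by
      intro a ha
      have hab : a ≤ b := Nat.divisor_le ha
      have ha0 : a ≠ 0 := (Nat.pos_of_mem_divisors ha).ne'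
      have hle : a * b ^ 2 ≤ N ^ (3 * k) := by
        calc a * b ^ 2 ≤ N ^ k * (N ^ k) ^ 2 :=
              Nat.mul_le_mul (hab.trans hb.2) (Nat.pow_le_pow_left hb.2 2)
          _ = N ^ (3 * k) := by ring
      have := hdiv (a * b ^ 2) (mul_ne_zero ha0 (pow_ne_zero 2 (by omega))) hle
      rw [card_product, tuples, Fintype.card_piFinset_const]
      push_cast
      rw [← pow_add, ← two_mul]
      gcongr
    calc _ ≤ ∑ a ∈ b.divisors, D ^ (2 * k) := sum_le_sum h1
      _ = (#b.divisors : ℝ) * D ^ (2 * k) := by rw [sum_const, nsmul_eq_mul]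
      _ ≤ D * D ^ (2 * k) := by
          gcongr
          exact hdiv b (by omega) (hb.2.trans (Nat.pow_le_pow_right hN (by omega)))
      _ = D ^ (2 * k + 1) := (pow_succ' _ _).symm
  have hcard : (energy k (Icc 1 N) (fun x => (x : ℚ)⁻¹) : ℝ) ≤ (N : ℝ) ^ k * D ^ (2 * k + 1) := by
    calc (energy k (Icc 1 N) (fun x => (x : ℚ)⁻¹) : ℝ)
        ≤ ((∑ b ∈ Icc 1 (N ^ k), ∑ a ∈ b.divisors,
            #(tuples k (a * b ^ 2).divisors ×ˢ tuples k (a * b ^ 2).divisors) : ℕ) : ℝ) := by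
          refine Nat.cast_le.mpr ((card_le_card (energy_inv_subset k N)).trans ?_)
          refine card_biUnion_le.trans (sum_le_sum fun b _ => card_biUnion_le)
      _ ≤ ∑ b ∈ Icc 1 (N ^ k), D ^ (2 * k + 1) := by
          push_cast
          exact sum_le_sum hb
      _ = _ := by simp
  refine hcard.trans (le_of_eq ?_)
  have hθ' : (((N : ℝ) ^ (3 * k)) ^ θ) ^ (2 * k + 1) = (N : ℝ) ^ η := by
    rw [← Real.rpow_natCast, ← Real.rpow_natCast, ← Real.rpow_mul (by positivity),
      ← Real.rpow_mul (by positivity)]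
    congr 1
    rw [hθ]
    push_cast
    field_simp
  rw [hD, mul_pow, hθ']
  ring

/-! ### From congruences to equations. -/

section spacing

variable {k : ℕ}

/-- The numerator of `∑ 1 / x i` over the common denominator `∏ x i`. -/
def unitFractionNumerator (x : Fin k → ℕ) : ℕ :=
  ∑ i, ∏ j ∈ univ.erase i, x j

/-- Stated over a general ring so that the same integer numerator appears in `ℚ` and in `ZMod m`. -/
lemma prod_mul_sum_inv {R : Type*} [CommRing R] (x : Fin k → ℕ) (r : Fin k → R)
    (hr : ∀ i, (x i : R) * r i = 1) :
    (∏ i, (x i : R)) * ∑ i, r i = (unitFractionNumerator x : R) := by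
  rw [unitFractionNumerator, mul_sum]
  push_cast
  refine sum_congr rfl fun i _ => ?_
  rw [← mul_prod_erase univ (fun j => (x j : R)) (mem_univ i), mul_right_comm, hr, one_mul]

lemma natCast_mul_inv_zmod {m x : ℕ} (h : x.Coprime m) : (x : ZMod m) * (x : ZMod m)⁻¹ = 1 :=
  ZMod.coe_mul_inv_eq_one x h

/-- Distinct sums of unit fractions that agree modulo `m` are far apart. -/
lemma le_abs_sub_of_sum_inv_zmod_eq {m N : ℕ} (x y : Fin k → ℕ)
    (hx : ∀ i, 1 ≤ x i ∧ x i ≤ N ∧ (x i).Coprime m) (hy : ∀ i, 1 ≤ y i ∧ y i ≤ N ∧ (y i).Coprime m)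
    (hmod : ∑ i, (x i : ZMod m)⁻¹ = ∑ i, (y i : ZMod m)⁻¹)
    (hne : ∑ i, (x i : ℚ)⁻¹ ≠ ∑ i, (y i : ℚ)⁻¹) :
    (m : ℚ) ≤ |∑ i, (x i : ℚ)⁻¹ - ∑ i, (y i : ℚ)⁻¹| * (N : ℚ) ^ (2 * k) := by
  have hpos : ∀ z : Fin k → ℕ, (∀ i, 1 ≤ z i ∧ z i ≤ N ∧ (z i).Coprime m) →
      (0 : ℚ) < ∏ i, (z i : ℚ) ∧ ∏ i, (z i : ℚ) ≤ (N : ℚ) ^ k := fun z hz => by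
    refine ⟨prod_pos fun i _ => by exact_mod_cast (hz i).1, ?_⟩
    have := prod_le_pow_card univ z N fun i _ => (hz i).2.1
    simp only [card_univ, Fintype.card_fin] at this
    exact_mod_cast this
  have hQ : ∀ z : Fin k → ℕ, (∀ i, 1 ≤ z i ∧ z i ≤ N ∧ (z i).Coprime m) →
      (∏ i, (z i : ℚ)) * ∑ i, (z i : ℚ)⁻¹ = (unitFractionNumerator z : ℚ) := fun z hz =>
    prod_mul_sum_inv z _ fun i => mul_inv_cancel₀ (by have := (hz i).1; positivity)
  have hZ : ∀ z : Fin k → ℕ, (∀ i, 1 ≤ z i ∧ z i ≤ N ∧ (z i).Coprime m) →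
      (∏ i, (z i : ZMod m)) * ∑ i, (z i : ZMod m)⁻¹ = (unitFractionNumerator z : ZMod m) :=
    fun z hz => prod_mul_sum_inv z _ fun i => natCast_mul_inv_zmod (hz i).2.2
  -- The numerator of the difference over the product of all denominators: a nonzero multiple of
  -- `m`, while that product is at most `N ^ (2k)`.
  set D : ℤ := (unitFractionNumerator x : ℤ) * ∏ i, (y i : ℤ)
    - (unitFractionNumerator y : ℤ) * ∏ i, (x i : ℤ) with hD
  have hDQ : (D : ℚ) = (∑ i, (x i : ℚ)⁻¹ - ∑ i, (y i : ℚ)⁻¹)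
      * ((∏ i, (x i : ℚ)) * ∏ i, (y i : ℚ)) := by
    rw [hD]
    push_cast
    rw [← hQ x hx, ← hQ y hy]
    ring
  have hdvd : (m : ℤ) ∣ D := by
    rw [← ZMod.intCast_zmod_eq_zero_iff_dvd, hD]
    push_cast
    rw [← hZ x hx, ← hZ y hy, hmod]
    ring
  have hD0 : D ≠ 0 := by
    intro h
    rw [h, Int.cast_zero, eq_comm, mul_eq_zero, sub_eq_zero] at hDQ
    exact hDQ.elim hne (mul_pos (hpos x hx).1 (hpos y hy).1).ne'
  have hmD : (m : ℤ) ≤ |D| := Int.le_of_dvd (abs_pos.mpr hD0) ((dvd_abs _ _).mpr hdvd)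
  have hmD' : (m : ℚ) ≤ |(D : ℚ)| := by exact_mod_cast hmD
  refine hmD'.trans ?_
  rw [hDQ, abs_mul, two_mul, pow_add]
  gcongr
  rw [abs_of_pos (mul_pos (hpos x hx).1 (hpos y hy).1)]
  exact mul_le_mul (hpos x hx).2 (hpos y hy).2 (hpos y hy).1.le (by positivity)

end spacing

/-- A finite set of reals in `[0, L]` with gaps at least `g` has at most `L / g + 1` elements. -/
lemma card_le_of_gaps {ι : Type*} (T : Finset ι) (q : ι → ℝ) {L g : ℝ} (hg : 0 < g) (hL : 0 ≤ L)
    (h0 : ∀ t ∈ T, 0 ≤ q t ∧ q t ≤ L)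
    (hgap : ∀ s ∈ T, ∀ t ∈ T, s ≠ t → g ≤ |q s - q t|) :
    (#T : ℝ) ≤ L / g + 1 := by
  have hcard : #T ≤ #(range (⌊L / g⌋₊ + 1)) := by
    refine card_le_card_of_injOn (fun t => ⌊q t / g⌋₊) (fun t ht => ?_) fun s hs t ht hst => ?_
    · simp only [coe_range, Set.mem_Iio, Nat.lt_succ_iff]
      exact Nat.floor_le_floor (by have := (h0 t ht).2; gcongr)
    · by_contra hne
      have h1 := hgap s hs t ht hne
      have h2 : |q s / g - q t / g| < 1 := by
        have hs1 := Nat.floor_le (div_nonneg (h0 s hs).1 hg.le)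
        have ht1 := Nat.floor_le (div_nonneg (h0 t ht).1 hg.le)
        have hs2 := Nat.lt_floor_add_one (q s / g)
        have ht2 := Nat.lt_floor_add_one (q t / g)
        have hst' : (⌊q s / g⌋₊ : ℝ) = ⌊q t / g⌋₊ := by exact_mod_cast hst
        rw [abs_lt]
        constructor <;> linarith
      rw [← sub_div, abs_div, abs_of_pos hg, div_lt_one hg] at h2
      linarith
  rw [card_range] at hcard
  calc (#T : ℝ) ≤ ⌊L / g⌋₊ + 1 := by exact_mod_cast hcard
    _ ≤ _ := by
      have := Nat.floor_le (div_nonneg hL hg.le)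
      linarith

/-- If every fibre of `g` on `S` meets at most `K` fibres of `q`, then the collisions of `g` are at
most `K` times as many as those of `q`. -/
lemma card_collisions_le {α β γ : Type*} [DecidableEq α] [DecidableEq β] [DecidableEq γ]
    [Fintype β] (S : Finset α) (g : α → β) (q : α → γ) (K : ℝ)
    (hK : ∀ s, (#({x ∈ S | g x = s}.image q) : ℝ) ≤ K) :
    (#{p ∈ S ×ˢ S | g p.1 = g p.2} : ℝ) ≤ K * #{p ∈ S ×ˢ S | q p.1 = q p.2} := by
  have hfib : #{p ∈ S ×ˢ S | g p.1 = g p.2} = ∑ s, #{x ∈ S | g x = s} ^ 2 := by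
    rw [card_eq_sum_card_fiberwise (f := fun p => g p.1) (t := univ) fun _ _ => by simp]
    refine sum_congr rfl fun s _ => ?_
    rw [sq, ← card_product]
    congr 1
    ext p
    simp only [mem_filter, mem_product]
    constructor
    · rintro ⟨⟨⟨h1, h2⟩, h3⟩, h4⟩
      exact ⟨⟨h1, h4⟩, h2, h3 ▸ h4⟩
    · rintro ⟨⟨h1, h4⟩, h2, h3⟩
      exact ⟨⟨⟨h1, h2⟩, h4.trans h3.symm⟩, h4⟩
  -- Cauchy-Schwarz over the at most `K` values that `q` takes on the fibre.
  have hrep : ∀ s, (#{x ∈ S | g x = s} : ℝ) ^ 2 ≤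
      K * ∑ t ∈ {x ∈ S | g x = s}.image q, (#{x ∈ {x ∈ S | g x = s} | q x = t} : ℝ) ^ 2 := by
    intro s
    have h1 : #{x ∈ S | g x = s} = ∑ t ∈ {x ∈ S | g x = s}.image q,
        #{x ∈ {x ∈ S | g x = s} | q x = t} :=
      card_eq_sum_card_fiberwise fun x hx => mem_image_of_mem q hx
    conv_lhs => rw [h1]
    push_cast
    refine sq_sum_le_card_mul_sum_sq.trans ?_
    gcongr
    exact hK s
  have h1 : ∀ s, ∑ t ∈ {x ∈ S | g x = s}.image q, #{x ∈ {x ∈ S | g x = s} | q x = t} ^ 2 =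
      #{p ∈ S ×ˢ S | (g p.1 = s ∧ g p.2 = s) ∧ q p.1 = q p.2} := by
    intro s
    rw [card_eq_sum_card_fiberwise (f := fun p => q p.1) (t := {x ∈ S | g x = s}.image q)]
    · refine sum_congr rfl fun t _ => ?_
      rw [sq, ← card_product]
      congr 1
      ext p
      simp only [mem_filter, mem_product]
      constructor
      · rintro ⟨⟨⟨h1, h2⟩, h3⟩, ⟨h4, h5⟩, h6⟩
        exact ⟨⟨⟨h1, h4⟩, ⟨h2, h5⟩, h3.trans h6.symm⟩, h3⟩
      · rintro ⟨⟨⟨h1, h4⟩, ⟨h2, h5⟩, h3⟩, h6⟩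
        exact ⟨⟨⟨h1, h2⟩, h6⟩, ⟨h4, h5⟩, h3 ▸ h6⟩
    · intro p hp
      simp only [coe_filter, mem_product, Set.mem_ofPred_eq] at hp
      exact mem_image_of_mem q (mem_filter.mpr ⟨hp.1.1, hp.2.1.1⟩)
  have htotal : ∑ s, ∑ t ∈ {x ∈ S | g x = s}.image q, #{x ∈ {x ∈ S | g x = s} | q x = t} ^ 2 ≤
      #{p ∈ S ×ˢ S | q p.1 = q p.2} := by
    simp_rw [h1]
    rw [← card_biUnion]
    · refine card_le_card fun p hp => ?_
      simp only [mem_biUnion, mem_univ, true_and, mem_filter] at hp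
      obtain ⟨s, h, -, h'⟩ := hp
      exact mem_filter.mpr ⟨h, h'⟩
    · intro s _ t _ hst
      refine disjoint_left.mpr fun p hp hp' => hst ?_
      exact (mem_filter.mp hp).2.1.1.symm.trans (mem_filter.mp hp').2.1.1
  rcases isEmpty_or_nonempty β with hβ | ⟨⟨b⟩⟩
  · simp [eq_empty_of_forall_notMem fun x (_ : x ∈ S) => hβ.elim (g x)]
  have hK0 : 0 ≤ K := (Nat.cast_nonneg _).trans (hK b)
  rw [hfib]
  push_cast
  calc ∑ s, (#{x ∈ S | g x = s} : ℝ) ^ 2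
      ≤ ∑ s, K * ∑ t ∈ {x ∈ S | g x = s}.image q,
          (#{x ∈ {x ∈ S | g x = s} | q x = t} : ℝ) ^ 2 := sum_le_sum fun s _ => hrep s
    _ = K * ((∑ s, ∑ t ∈ {x ∈ S | g x = s}.image q,
          #{x ∈ {x ∈ S | g x = s} | q x = t} ^ 2 : ℕ) : ℝ) := by
        rw [← mul_sum]
        push_cast
        rfl
    _ ≤ _ := by gcongr

/-- Passage from a congruence between sums of reciprocals to an equation between them. -/
theorem energy_zmod_inv_le {m k N : ℕ} [NeZero m] {M : ℝ} (hM : 0 < M) (hN : 1 ≤ N)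
    (A : Finset ℕ) (hA : ∀ x ∈ A, M < x ∧ x ≤ N ∧ x.Coprime m) :
    (energy k A (fun x => (x : ZMod m)⁻¹) : ℝ) ≤
      (k / M * (N : ℝ) ^ (2 * k) / m + 1) * energy k A (fun x => (x : ℚ)⁻¹) := by
  have hA' : ∀ x ∈ A, 1 ≤ x ∧ x ≤ N ∧ x.Coprime m := fun x hx => by
    refine ⟨?_, (hA x hx).2⟩
    have h : (0 : ℝ) < x := hM.trans (hA x hx).1
    exact_mod_cast h
  have hm : (0 : ℝ) < m := by exact_mod_cast Nat.pos_of_ne_zero (NeZero.ne m)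
  have hNpos : (0 : ℝ) < N := by exact_mod_cast hN
  refine card_collisions_le (tuples k A) (fun x => ∑ i, (x i : ZMod m)⁻¹)
    (fun x => ∑ i, (x i : ℚ)⁻¹) _ fun s => ?_
  rw [← div_div_eq_mul_div]
  refine card_le_of_gaps _ (fun t : ℚ => (t : ℝ)) (by positivity) (by positivity) ?_ ?_
  · intro t ht
    simp only [mem_image, mem_filter, mem_tuples] at ht
    obtain ⟨x, ⟨hx, -⟩, rfl⟩ := ht
    rw [Rat.cast_sum]
    simp only [Rat.cast_inv, Rat.cast_natCast]
    refine ⟨sum_nonneg fun i _ => by positivity, ?_⟩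
    calc ∑ i, (x i : ℝ)⁻¹ ≤ ∑ _i : Fin k, M⁻¹ :=
          sum_le_sum fun i _ => inv_anti₀ hM (hA _ (hx i)).1.le
      _ = k / M := by simp [div_eq_mul_inv]
  · intro t ht u hu htu
    simp only [mem_image, mem_filter, mem_tuples] at ht hu
    obtain ⟨x, ⟨hx, hxs⟩, rfl⟩ := ht
    obtain ⟨y, ⟨hy, hys⟩, rfl⟩ := hu
    have := le_abs_sub_of_sum_inv_zmod_eq x y (fun i => hA' _ (hx i)) (fun i => hA' _ (hy i))
      (hxs.trans hys.symm) htu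
    rw [div_le_iff₀ (by positivity), ← Rat.cast_sub, ← Rat.cast_abs]
    exact_mod_cast this

/-! ### Exponential sums and the bilinear inequality. -/

/-- The weighted power mean inequality, without normalization of the weights. -/
lemma sum_mul_pow_le {ι : Type*} (s : Finset ι) (r t : ι → ℝ) (hr : ∀ i ∈ s, 0 ≤ r i)
    (ht : ∀ i ∈ s, 0 ≤ t i) {k : ℕ} (hk : 1 ≤ k) :
    (∑ i ∈ s, r i * t i) ^ k ≤ (∑ i ∈ s, r i) ^ (k - 1) * ∑ i ∈ s, r i * t i ^ k := by
  set W := ∑ i ∈ s, r i with hW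
  have hW0 : 0 ≤ W := sum_nonneg hr
  rcases hW0.eq_or_lt with h0 | hpos
  · have hz : ∀ i ∈ s, r i = 0 := (sum_eq_zero_iff_of_nonneg hr).mp h0.symm
    have h1 : ∑ i ∈ s, r i * t i = 0 := sum_eq_zero fun i hi => by rw [hz i hi, zero_mul]
    rw [h1, zero_pow (by omega)]
    exact mul_nonneg (pow_nonneg hW0 _)
      (sum_nonneg fun i hi => mul_nonneg (hr i hi) (pow_nonneg (ht i hi) _))
  · have := Real.pow_arith_mean_le_arith_mean_pow s (fun i => r i / W) t
      (fun i hi => div_nonneg (hr i hi) hW0) (by rw [← sum_div]; exact div_self hpos.ne') ht k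
    simp_rw [div_mul_eq_mul_div, ← sum_div] at this
    rw [div_pow, div_le_div_iff₀ (by positivity) hpos] at this
    obtain ⟨l, rfl⟩ : ∃ l, k = l + 1 := ⟨k - 1, by omega⟩
    rw [Nat.add_sub_cancel]
    refine le_of_mul_le_mul_right (this.trans_eq ?_) hpos
    ring

lemma map_sum_eq_prod {G R ι : Type*} [AddCommMonoid G] [CommMonoid R] (ψ : AddChar G R)
    (s : Finset ι) (f : ι → G) : ψ (∑ i ∈ s, f i) = ∏ i ∈ s, ψ (f i) := by
  classical
  induction s using Finset.induction_on with
  | empty => simp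
  | insert i s hi ih => rw [sum_insert hi, prod_insert hi, AddChar.map_add_eq_mul, ih]

section character

variable {m : ℕ} [NeZero m]

/-- Parseval's identity on `ZMod m`, twisted by a unit. -/
lemma sum_norm_sq_eq (a : ZMod m) (ha : IsUnit a) (B : ZMod m → ℂ) :
    ∑ c, ‖∑ μ, B μ * ZMod.stdAddChar (a * c * μ)‖ ^ 2 = m * ∑ μ, ‖B μ‖ ^ 2 := by
  have hconj : ∀ z : ZMod m, (starRingEnd ℂ) (ZMod.stdAddChar z) = ZMod.stdAddChar (-z) :=
    fun z => (AddChar.map_neg_eq_conj _ z).symm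
  have horth : ∀ μ ν : ZMod m, ∑ c : ZMod m, (ZMod.stdAddChar (a * c * μ) *
      ZMod.stdAddChar (-(a * c * ν)) : ℂ) = if μ = ν then (m : ℂ) else 0 := by
    intro μ ν
    have h := AddChar.sum_mulShift (R := ZMod m) (ψ := ZMod.stdAddChar) (a * (μ - ν))
      (ZMod.isPrimitive_stdAddChar m)
    simp only [ha.mul_right_eq_zero, sub_eq_zero, ZMod.card] at h
    rw [Nat.cast_ite, Nat.cast_zero] at h
    rw [← h]
    refine sum_congr rfl fun c _ => ?_
    rw [← AddChar.map_add_eq_mul]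
    congr 1
    ring
  have hC : ((∑ c, ‖∑ μ, B μ * ZMod.stdAddChar (a * c * μ)‖ ^ 2 : ℝ) : ℂ)
      = ((m * ∑ μ, ‖B μ‖ ^ 2 : ℝ) : ℂ) := by
    push_cast
    calc ∑ c, (‖∑ μ, B μ * ZMod.stdAddChar (a * c * μ)‖ : ℂ) ^ 2
        = ∑ c : ZMod m, ∑ μ, ∑ ν, B μ * (starRingEnd ℂ) (B ν) *
            (ZMod.stdAddChar (a * c * μ) * ZMod.stdAddChar (-(a * c * ν))) := by
          refine sum_congr rfl fun c _ => ?_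
          rw [← Complex.mul_conj', map_sum, sum_mul_sum]
          refine sum_congr rfl fun μ _ => sum_congr rfl fun ν _ => ?_
          rw [map_mul (starRingEnd ℂ), hconj]
          ring
      _ = ∑ μ, ∑ ν, B μ * (starRingEnd ℂ) (B ν) * ∑ c : ZMod m,
            (ZMod.stdAddChar (a * c * μ) * ZMod.stdAddChar (-(a * c * ν))) := by
          rw [sum_comm]
          refine sum_congr rfl fun μ _ => ?_
          rw [sum_comm]
          simp_rw [mul_sum]
      _ = ∑ μ, B μ * (starRingEnd ℂ) (B μ) * m := by
          simp_rw [horth, mul_ite, mul_zero]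
          simp
      _ = m * ∑ μ, (‖B μ‖ : ℂ) ^ 2 := by
          rw [mul_sum]
          refine sum_congr rfl fun μ _ => ?_
          rw [Complex.mul_conj', mul_comm]
  exact_mod_cast hC

/-- A weighted exponential sum over reciprocals. -/
noncomputable def recipSum (A : Finset ℕ) (α : ℕ → ℂ) (c : ZMod m) : ℂ :=
  ∑ x ∈ A, α x * ZMod.stdAddChar (c * (x : ZMod m)⁻¹)

/-- Expand the power and group the tuples by the value `μ` of their sum of reciprocals. -/
lemma exists_recipSum_pow_eq (k : ℕ) (A : Finset ℕ) (α : ℕ → ℂ) (hα : ∀ x ∈ A, ‖α x‖ ≤ 1) :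
    ∃ B : ZMod m → ℂ, (∀ μ, ‖B μ‖ ≤ repCount k A (fun x => (x : ZMod m)⁻¹) μ) ∧
      ∀ c : ZMod m, recipSum A α c ^ k = ∑ μ, B μ * ZMod.stdAddChar (c * μ) := by
  refine ⟨fun μ => ∑ x ∈ tuples k A with ∑ i, (x i : ZMod m)⁻¹ = μ, ∏ i, α (x i),
    fun μ => ?_, fun c => ?_⟩
  · refine (norm_sum_le _ _).trans ?_
    rw [repCount, card_eq_sum_ones]
    push_cast
    refine sum_le_sum fun x hx => ?_
    rw [norm_prod]
    exact prod_le_one (fun _ _ => norm_nonneg _)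
      fun i _ => hα _ (mem_tuples.mp (mem_filter.mp hx).1 i)
  · rw [recipSum, sum_pow', ← tuples, ← sum_fiberwise (tuples k A)
      (fun x : Fin k → ℕ => ∑ i, (x i : ZMod m)⁻¹)]
    refine sum_congr rfl fun μ _ => ?_
    rw [sum_mul]
    refine sum_congr rfl fun x hx => ?_
    rw [prod_mul_distrib, ← (mem_filter.mp hx).2, mul_sum, map_sum_eq_prod]

/-- Parseval: the coefficients of the `k`-th power are dominated by `repCount`, whose squares sum to
the energy. -/
lemma sum_norm_recipSum_pow_le (k : ℕ) (A : Finset ℕ) (α : ℕ → ℂ) (hα : ∀ x ∈ A, ‖α x‖ ≤ 1)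
    (a : ZMod m) (ha : IsUnit a) :
    ∑ c, (‖recipSum A α (a * c)‖ ^ k) ^ 2 ≤ m * energy k A (fun x => (x : ZMod m)⁻¹) := by
  obtain ⟨B, hB, hpow⟩ := exists_recipSum_pow_eq (m := m) k A α hα
  have hn : ∀ c : ZMod m, ‖recipSum A α (a * c)‖ ^ k =
      ‖∑ μ, B μ * ZMod.stdAddChar (a * c * μ)‖ := fun c => by rw [← norm_pow, hpow]
  simp_rw [hn]
  rw [sum_norm_sq_eq a ha, energy_eq_sum_sq k A _ univ fun _ _ => mem_univ _]
  push_cast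
  gcongr with μ
  exact hB μ

lemma sum_repCount (k : ℕ) (A : Finset ℕ) :
    ∑ μ, (repCount k A (fun x => (x : ZMod m)⁻¹) μ : ℝ) = (#A : ℝ) ^ k := by
  have : ∑ μ, repCount k A (fun x => (x : ZMod m)⁻¹) μ = #(tuples k A) :=
    (card_eq_sum_card_fiberwise fun _ _ => mem_coe.mpr (mem_univ _)).symm
  rw [tuples, Fintype.card_piFinset_const] at this
  exact_mod_cast this

/-- The bilinear sum is controlled by the energies of the two sets of reciprocals. -/
theorem norm_bilinear_pow_le {k₁ k₂ : ℕ} (hk₁ : 1 ≤ k₁) (hk₂ : 1 ≤ k₂) (A B : Finset ℕ)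
    (α β : ℕ → ℂ) (hα : ∀ x ∈ A, ‖α x‖ ≤ 1) (hβ : ∀ x ∈ B, ‖β x‖ ≤ 1) (a : ZMod m)
    (ha : IsUnit a) :
    ‖∑ x ∈ A, ∑ y ∈ B, α x * β y *
        ZMod.stdAddChar (a * (x : ZMod m)⁻¹ * (y : ZMod m)⁻¹)‖ ^ (2 * k₁ * k₂) ≤
      (#A : ℝ) ^ (2 * k₁ * (k₂ - 1)) * (#B : ℝ) ^ (2 * k₂ * (k₁ - 1)) *
        (m * energy k₁ A (fun x => (x : ZMod m)⁻¹) * energy k₂ B (fun x => (x : ZMod m)⁻¹)) := by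
  set S := ∑ x ∈ A, ∑ y ∈ B, α x * β y *
    ZMod.stdAddChar (a * (x : ZMod m)⁻¹ * (y : ZMod m)⁻¹) with hS
  set V : ℕ → ℂ := fun x => recipSum B β (a * (x : ZMod m)⁻¹) with hV
  have h1 : ‖S‖ ≤ ∑ x ∈ A, 1 * ‖V x‖ := by
    rw [hS]
    refine (norm_sum_le _ _).trans (sum_le_sum fun x hx => ?_)
    simp_rw [mul_assoc (α x), ← mul_sum, norm_mul]
    exact mul_le_mul_of_nonneg_right (hα x hx) (norm_nonneg _)
  -- First Hölder step, in `x`: the power `V x ^ k₂` is a combination of characters in `μ` with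
  -- coefficients at most `r μ`.
  have h2 : ‖S‖ ^ k₂ ≤ (#A : ℝ) ^ (k₂ - 1) * ∑ x ∈ A, ‖V x‖ ^ k₂ := by
    refine (pow_le_pow_left₀ (norm_nonneg _) h1 k₂).trans ?_
    have := sum_mul_pow_le A (fun _ => 1) (fun x => ‖V x‖) (by simp) (by simp) hk₂
    simpa using this
  obtain ⟨b, hb, hpow⟩ := exists_recipSum_pow_eq (m := m) k₂ B β hβ
  set r : ZMod m → ℝ := fun μ => repCount k₂ B (fun x => (x : ZMod m)⁻¹) μ with hr
  -- Phases that remove the absolute value from `V x ^ k₂`; they become the new bounded weights on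
  -- `A`.
  have hθ : ∀ z : ℂ, ∃ θ : ℂ, ‖θ‖ ≤ 1 ∧ θ * z = ‖z‖ := by
    intro z
    rcases eq_or_ne z 0 with rfl | hz
    · exact ⟨0, by simp⟩
    · have : ‖z‖ ≠ 0 := norm_ne_zero_iff.mpr hz
      refine ⟨‖z‖ / z, ?_, div_mul_cancel₀ _ hz⟩
      rw [norm_div, Complex.norm_real, norm_norm, div_self this]
  choose Θ hΘ1 hΘ2 using hθ
  set θ : ℕ → ℂ := fun x => Θ (V x ^ k₂) with hθdef
  have h3 : ∑ x ∈ A, ‖V x‖ ^ k₂ ≤ ∑ μ, r μ * ‖recipSum A θ (a * μ)‖ := by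
    have h4 : ((∑ x ∈ A, ‖V x‖ ^ k₂ : ℝ) : ℂ) = ∑ μ, b μ * recipSum A θ (a * μ) := by
      push_cast
      simp_rw [recipSum, mul_sum]
      rw [sum_comm]
      refine sum_congr rfl fun x _ => ?_
      have h5 : θ x * V x ^ k₂ = (‖V x‖ : ℂ) ^ k₂ := by
        rw [hθdef]
        simp only
        rw [hΘ2, norm_pow]
        push_cast
        rfl
      rw [← h5, hV]
      simp only
      rw [hpow, mul_sum]
      refine sum_congr rfl fun μ _ => ?_
      rw [mul_right_comm a]
      ring
    have h6 : 0 ≤ ∑ x ∈ A, ‖V x‖ ^ k₂ := sum_nonneg fun _ _ => by positivity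
    rw [← abs_of_nonneg h6, ← Real.norm_eq_abs, ← Complex.norm_real, h4]
    refine (norm_sum_le _ _).trans (sum_le_sum fun μ _ => ?_)
    rw [norm_mul]
    exact mul_le_mul_of_nonneg_right (hb μ) (norm_nonneg _)
  have hr0 : ∀ μ, 0 ≤ r μ := fun μ => Nat.cast_nonneg _
  have hrsum : ∑ μ, r μ = (#B : ℝ) ^ k₂ := sum_repCount k₂ B
  -- Second Hölder step, with weights `r` of total mass `#B ^ k₂`. Cauchy-Schwarz then separates `r`
  -- from the moment over `A`.
  have h7 : (∑ μ, r μ * ‖recipSum A θ (a * μ)‖) ^ k₁ ≤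
      ((#B : ℝ) ^ k₂) ^ (k₁ - 1) * ∑ μ, r μ * ‖recipSum A θ (a * μ)‖ ^ k₁ := by
    rw [← hrsum]
    exact sum_mul_pow_le univ r _ (fun μ _ => hr0 μ) (fun _ _ => norm_nonneg _) hk₁
  have h8 : (∑ μ, r μ * ‖recipSum A θ (a * μ)‖ ^ k₁) ^ 2 ≤
      energy k₂ B (fun x => (x : ZMod m)⁻¹) * (m * energy k₁ A (fun x => (x : ZMod m)⁻¹)) := by
    refine (sum_mul_sq_le_sq_mul_sq _ _ _).trans ?_
    refine mul_le_mul (le_of_eq ?_)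
      (sum_norm_recipSum_pow_le k₁ A θ (fun x _ => hΘ1 _) a ha)
      (sum_nonneg fun _ _ => by positivity) (by positivity)
    rw [energy_eq_sum_sq k₂ B _ univ fun _ _ => mem_univ _]
    push_cast
    rfl
  have hAnn : (0 : ℝ) ≤ #A := Nat.cast_nonneg _
  calc ‖S‖ ^ (2 * k₁ * k₂) = ((‖S‖ ^ k₂) ^ k₁) ^ 2 := by
        rw [← pow_mul, ← pow_mul]
        congr 1
        ring
    _ ≤ (((#A : ℝ) ^ (k₂ - 1) * ∑ μ, r μ * ‖recipSum A θ (a * μ)‖) ^ k₁) ^ 2 := by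
        gcongr
        exact h2.trans (by gcongr)
    _ ≤ (((#A : ℝ) ^ (k₂ - 1)) ^ k₁ * (((#B : ℝ) ^ k₂) ^ (k₁ - 1) *
          ∑ μ, r μ * ‖recipSum A θ (a * μ)‖ ^ k₁)) ^ 2 := by
        rw [mul_pow]
        have : 0 ≤ ∑ μ, r μ * ‖recipSum A θ (a * μ)‖ :=
          sum_nonneg fun μ _ => mul_nonneg (hr0 μ) (norm_nonneg _)
        gcongr
    _ = ((#A : ℝ) ^ (2 * k₁ * (k₂ - 1)) * (#B : ℝ) ^ (2 * k₂ * (k₁ - 1))) *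
          (∑ μ, r μ * ‖recipSum A θ (a * μ)‖ ^ k₁) ^ 2 := by
        rw [mul_pow, mul_pow, ← mul_assoc]
        simp_rw [← pow_mul]
        congr 3 <;> ring
    _ ≤ _ := by
        refine mul_le_mul_of_nonneg_left (h8.trans_eq (by ring)) (by positivity)

end character

/-! ### The choice of `k` and the critical windows. -/

/-- The integers in `(N * m ^ (-η), N]` coprime to `m`. -/
noncomputable def truncatedUnits (m N : ℕ) (η : ℝ) : Finset ℕ :=
  {x ∈ Icc 1 N | x.Coprime m ∧ (N : ℝ) * (m : ℝ) ^ (-η) < x}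

/-- The factor from `energy_zmod_inv_le` has two terms: `h1` controls the one from spacing, `h2` the
summand `1`, with a common saving `g`. -/
lemma energy_truncatedUnits_le {m N k : ℕ} [NeZero m] {η C g : ℝ} (hη : 0 < η) (hN : 1 ≤ N)
    (hk : 1 ≤ k) (hg : 0 ≤ g) (hC : 1 ≤ C)
    (hE : (energy k (truncatedUnits m N η) (fun x => (x : ℚ)⁻¹) : ℝ) ≤
      C * (N : ℝ) ^ k * (m : ℝ) ^ η)
    (h1 : (N : ℝ) ^ (k - 1) ≤ (m : ℝ) ^ (1 / 2 : ℝ) * g)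
    (h2 : (m : ℝ) ^ (1 / 2 : ℝ) ≤ (N : ℝ) ^ k * g) :
    (m : ℝ) ^ (1 / 2 : ℝ) * energy k (truncatedUnits m N η) (fun x => (x : ZMod m)⁻¹) ≤
      C * (k + 1) * (m : ℝ) ^ (2 * η) * (N : ℝ) ^ (2 * k) * g := by
  have hm1 : (1 : ℝ) ≤ m := by exact_mod_cast Nat.pos_of_ne_zero (NeZero.ne m)
  have hm : (0 : ℝ) < m := by linarith
  have hN0 : (0 : ℝ) < N := by exact_mod_cast hN
  have hM : 0 < (N : ℝ) * (m : ℝ) ^ (-η) := by positivity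
  have hJ := energy_zmod_inv_le (k := k) hM hN (truncatedUnits m N η) fun x hx => by
    simp only [truncatedUnits, mem_filter, mem_Icc] at hx
    exact ⟨hx.2.2, hx.1.2, hx.2.1⟩
  set X : ℝ := (m : ℝ) ^ (1 / 2 : ℝ) with hX
  set P : ℝ := (m : ℝ) ^ η with hP
  have hX0 : 0 < X := by positivity
  have hP1 : 1 ≤ P := Real.one_le_rpow hm1 hη.le
  have hXX : (m : ℝ) = X * X := by
    rw [hX, ← Real.rpow_add hm]
    norm_num
  have hPP : (m : ℝ) ^ (2 * η) = P * P := by rw [hP, ← Real.rpow_add hm, two_mul]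
  have hPinv : (m : ℝ) ^ (-η) = P⁻¹ := Real.rpow_neg hm.le _
  rw [hPP]
  rw [hPinv] at hJ
  obtain ⟨l, rfl⟩ : ∃ l, k = l + 1 := ⟨k - 1, by omega⟩
  rw [Nat.add_sub_cancel] at h1
  set k' : ℝ := ((l + 1 : ℕ) : ℝ) with hk'
  have hk0 : 0 ≤ k' := Nat.cast_nonneg _
  calc X * (energy (l + 1) (truncatedUnits m N η) (fun x => (x : ZMod m)⁻¹) : ℝ)
      ≤ X * ((k' / (N * P⁻¹) * (N : ℝ) ^ (2 * (l + 1)) / m + 1) *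
          (C * (N : ℝ) ^ (l + 1) * P)) := by
        gcongr
        exact hJ.trans (by gcongr)
    _ = C * P * (k' * P * (N : ℝ) ^ (2 * (l + 1)) * ((N : ℝ) ^ l / X) +
          (N : ℝ) ^ (l + 1) * X) := by
        rw [hXX]
        field_simp
        ring
    _ ≤ C * P * (k' * P * (N : ℝ) ^ (2 * (l + 1)) * g +
          (N : ℝ) ^ (l + 1) * ((N : ℝ) ^ (l + 1) * g)) := by
        gcongr
        rw [div_le_iff₀ hX0, mul_comm]
        exact h1
    _ = C * P * (k' * P + 1) * ((N : ℝ) ^ (2 * (l + 1)) * g) := by ring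
    _ ≤ C * P * (k' * P + P) * ((N : ℝ) ^ (2 * (l + 1)) * g) := by gcongr
    _ = _ := by ring

/-- Raising the bounds on `N` to the powers `k` and `k - 1` gains at least `m ^ e`. The exception is
`N ^ (k - 1) = 1` at `k = 1`, where the saving is at most `m ^ (1/2)`; hence the cap on `e₀`. -/
lemma exponent_window_bounds {m k : ℕ} {N e e₀ : ℝ} (hm : 1 ≤ m) (hk : 1 ≤ k) (hN : 0 < N)
    (he₀ : e₀ ≤ e) (he₀' : e₀ ≤ 1 / 2) (he : 0 ≤ e)
    (hlow : (m : ℝ) ^ (1 / (2 * (k : ℝ)) + e) ≤ N)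
    (hhigh : 2 ≤ k → N ≤ (m : ℝ) ^ (1 / (2 * ((k - 1 : ℕ) : ℝ)) - e)) :
    N ^ (k - 1) ≤ (m : ℝ) ^ (1 / 2 : ℝ) * (m : ℝ) ^ (-e₀) ∧
      (m : ℝ) ^ (1 / 2 : ℝ) ≤ N ^ k * (m : ℝ) ^ (-e₀) := by
  have hm1 : (1 : ℝ) ≤ m := by exact_mod_cast hm
  have hm0 : (0 : ℝ) < m := by linarith
  have hk1 : (1 : ℝ) ≤ k := by exact_mod_cast hk
  constructor
  · rw [← Real.rpow_add hm0]
    rcases Nat.lt_or_ge k 2 with h | h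
    · have : k - 1 = 0 := by omega
      rw [this, pow_zero]
      exact Real.one_le_rpow hm1 (by linarith)
    · refine (pow_le_pow_left₀ hN.le (hhigh h) _).trans ?_
      rw [← Real.rpow_natCast, ← Real.rpow_mul hm0.le]
      refine Real.rpow_le_rpow_of_exponent_le hm1 ?_
      set j := k - 1
      have hj : (1 : ℝ) ≤ (j : ℝ) := by exact_mod_cast (by omega : 1 ≤ j)
      have : (1 / (2 * (j : ℝ)) - e) * j = 1 / 2 - e * j := by field_simp
      rw [this]
      nlinarith
  · have h := pow_le_pow_left₀ (by positivity) hlow k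
    rw [← Real.rpow_natCast, ← Real.rpow_mul hm0.le] at h
    have h' : (m : ℝ) ^ (1 / 2 + e₀) ≤ N ^ k := by
      refine le_trans (Real.rpow_le_rpow_of_exponent_le hm1 ?_) h
      have : (1 / (2 * (k : ℝ)) + e) * k = 1 / 2 + e * k := by field_simp
      rw [this]
      nlinarith
    calc (m : ℝ) ^ (1 / 2 : ℝ) = (m : ℝ) ^ (1 / 2 + e₀) * (m : ℝ) ^ (-e₀) := by
          rw [← Real.rpow_add hm0]
          congr 1
          ring
      _ ≤ _ := by gcongr

/-- For every `N ≥ m ^ ε` some bounded `k` makes the number of solutions of the congruence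
`x₁* + ⋯ + x_k* ≡ y₁* + ⋯ + y_k*` almost as small as `N ^ (2k) / m ^ (1/2)`, with a power saving
when `N` lies outside the critical windows. -/
theorem exists_energy_truncatedUnits_le {ε η : ℝ} (hε : 0 < ε) (hη : 0 < η) :
    ∃ C : ℝ, 1 ≤ C ∧ ∃ K : ℕ, 1 ≤ K ∧ ∀ m : ℕ, 2 ≤ m → ∀ N : ℕ, (m : ℝ) ^ ε ≤ N →
      ∃ k : ℕ, 1 ≤ k ∧ k ≤ K ∧
        ((m : ℝ) ^ (1 / 2 : ℝ) * energy k (truncatedUnits m N η) (fun x => (x : ZMod m)⁻¹) ≤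
          C * (m : ℝ) ^ (2 * η) * (N : ℝ) ^ (2 * k)) ∧
        ((N : ℝ) ∉ criticalWindows m ε →
          (m : ℝ) ^ (1 / 2 : ℝ) * energy k (truncatedUnits m N η) (fun x => (x : ZMod m)⁻¹) ≤
            C * (m : ℝ) ^ (2 * η) * (N : ℝ) ^ (2 * k) * (m : ℝ) ^ (-min ε (1 / 2))) := by
  have hEk : ∀ k : ℕ, ∃ C : ℝ, 1 ≤ C ∧ (1 ≤ k → ∀ N : ℕ, 1 ≤ N →
      (energy k (Icc 1 N) (fun x => (x : ℚ)⁻¹) : ℝ) ≤ C * (N : ℝ) ^ k * (N : ℝ) ^ η) := by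
    intro k
    by_cases hk : 1 ≤ k
    · obtain ⟨C, h1, h2⟩ := exists_energy_inv_le hk hη
      exact ⟨C, h1, fun _ => h2⟩
    · exact ⟨1, le_rfl, fun h => absurd h hk⟩
  choose c hc1 hc using hEk
  -- Ensures `1 / (2K) ≤ ε`, so that `m ^ (1/(2K)) ≤ N`.
  set K : ℕ := ⌈1 / (2 * ε)⌉₊ + 1 with hK
  set D : ℝ := ∑ k ∈ range (K + 1), c k with hD
  have hcD : ∀ k ≤ K, c k ≤ D := fun k hk =>
    single_le_sum (f := c) (fun i _ => zero_le_one.trans (hc1 i)) (mem_range.mpr (by omega))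
  have hD1 : 1 ≤ D := (hc1 0).trans (hcD 0 (Nat.zero_le _))
  refine ⟨D * (K + 1), by nlinarith [(Nat.cast_nonneg K : (0 : ℝ) ≤ K)], K, by omega,
    fun m hm N hN => ?_⟩
  have : NeZero m := ⟨by omega⟩
  have hm1 : (1 : ℝ) ≤ m := by exact_mod_cast (by omega : 1 ≤ m)
  have hm0 : (0 : ℝ) < m := by linarith
  have hNpos : (0 : ℝ) < N := (Real.rpow_pos_of_pos hm0 ε).trans_le hN
  have hN1 : 1 ≤ N := by exact_mod_cast hNpos
  have hex : ∃ k : ℕ, 1 ≤ k ∧ (m : ℝ) ^ (1 / (2 * (k : ℝ))) ≤ N := by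
    refine ⟨K, by omega, (Real.rpow_le_rpow_of_exponent_le hm1 ?_).trans hN⟩
    have h1 : 1 / (2 * ε) ≤ K := (Nat.le_ceil _).trans (by rw [hK]; push_cast; linarith)
    have hK0 : (0 : ℝ) < K := by rw [hK]; positivity
    rw [div_le_iff₀ (by positivity)] at h1 ⊢
    linarith
  classical
  -- The least such `k` also gives `N < m ^ (1/(2(k-1)))` when `k ≥ 2`.
  obtain ⟨k, ⟨hk1, hklow⟩, hkmin⟩ : ∃ k : ℕ, (1 ≤ k ∧ (m : ℝ) ^ (1 / (2 * (k : ℝ))) ≤ N) ∧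
      ∀ j < k, ¬(1 ≤ j ∧ (m : ℝ) ^ (1 / (2 * (j : ℝ))) ≤ N) :=
    ⟨Nat.find hex, Nat.find_spec hex, fun j hj => Nat.find_min hex hj⟩
  have hkK : k ≤ K := by
    by_contra! h
    refine hkmin K h ⟨by omega, (Real.rpow_le_rpow_of_exponent_le hm1 ?_).trans hN⟩
    have h1 : 1 / (2 * ε) ≤ K := (Nat.le_ceil _).trans (by rw [hK]; push_cast; linarith)
    have hK0 : (0 : ℝ) < K := by rw [hK]; positivity
    rw [div_le_iff₀ (by positivity)] at h1 ⊢
    linarith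
  have hhigh : 2 ≤ k → (N : ℝ) < (m : ℝ) ^ (1 / (2 * ((k - 1 : ℕ) : ℝ))) := fun h => by
    have := hkmin (k - 1) (by omega)
    rw [not_and, not_le] at this
    exact this (by omega)
  have hsub : truncatedUnits m N η ⊆ Icc 1 N := filter_subset _ _
  have hE : (energy k (truncatedUnits m N η) (fun x => (x : ℚ)⁻¹) : ℝ) ≤
      D * (N : ℝ) ^ k * (m : ℝ) ^ η := by
    rcases Nat.lt_or_ge k 2 with h | h
    · obtain rfl : k = 1 := by omega
      have h1 : energy 1 (truncatedUnits m N η) (fun x => (x : ℚ)⁻¹) ≤ N :=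
        (energy_one_le_card fun x _ y _ hxy => by simpa using hxy).trans
          ((card_le_card hsub).trans_eq (by simp))
      calc (energy 1 (truncatedUnits m N η) (fun x => (x : ℚ)⁻¹) : ℝ) ≤ N := by exact_mod_cast h1
        _ = 1 * (N : ℝ) ^ 1 * 1 := by ring
        _ ≤ _ := by
          gcongr
          exact Real.one_le_rpow hm1 hη.le
    · have hNm : (N : ℝ) ≤ m := by
        refine (hhigh h).le.trans ?_
        conv_rhs => rw [← Real.rpow_one (m : ℝ)]
        refine Real.rpow_le_rpow_of_exponent_le hm1 ?_
        have : (1 : ℝ) ≤ ((k - 1 : ℕ) : ℝ) := by exact_mod_cast (by omega : 1 ≤ k - 1)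
        rw [div_le_one (by positivity)]
        linarith
      calc (energy k (truncatedUnits m N η) (fun x => (x : ℚ)⁻¹) : ℝ)
          ≤ energy k (Icc 1 N) (fun x => (x : ℚ)⁻¹) := by exact_mod_cast energy_mono k hsub _
        _ ≤ c k * (N : ℝ) ^ k * (N : ℝ) ^ η := hc k hk1 N hN1
        _ ≤ _ := by
          have := hcD k hkK
          gcongr
  have hgain : ∀ e e₀ : ℝ, e₀ ≤ e → e₀ ≤ 1 / 2 → 0 ≤ e →
      (m : ℝ) ^ (1 / (2 * (k : ℝ)) + e) ≤ N →
      (2 ≤ k → (N : ℝ) ≤ (m : ℝ) ^ (1 / (2 * ((k - 1 : ℕ) : ℝ)) - e)) →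
      (m : ℝ) ^ (1 / 2 : ℝ) * energy k (truncatedUnits m N η) (fun x => (x : ZMod m)⁻¹) ≤
        D * (K + 1) * (m : ℝ) ^ (2 * η) * (N : ℝ) ^ (2 * k) * (m : ℝ) ^ (-e₀) := by
    intro e e₀ h1 h2 h3 h4 h5
    obtain ⟨h6, h7⟩ := exponent_window_bounds (by omega) hk1 hNpos h1 h2 h3 h4 h5
    refine (energy_truncatedUnits_le hη hN1 hk1 (by positivity) hD1 hE h6 h7).trans ?_
    have : (k : ℝ) ≤ K := by exact_mod_cast hkK
    gcongr
  refine ⟨k, hk1, hkK, ?_, fun hwin => ?_⟩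
  · have := hgain 0 0 le_rfl (by norm_num) le_rfl (by simpa using hklow)
      (fun h => by simpa using (hhigh h).le)
    simpa using this
  -- `N` lies between the centres of windows `k` and `k - 1` (above the first centre if `k = 1`) and
  -- in neither window, so both bounds improve by `m ^ ε`.
  · simp only [criticalWindows, Set.mem_iUnion, not_exists, Set.mem_Icc, not_and, not_le] at hwin
    refine hgain ε _ (min_le_left _ _) (min_le_right _ _) hε.le (hwin k hk1 ?_).le fun h => ?_
    · exact (Real.rpow_le_rpow_of_exponent_le hm1 (by linarith)).trans hklow
    · by_contra! hcon
      refine absurd (hwin (k - 1) (by omega) hcon.le) (not_lt.mpr ((hhigh h).le.trans ?_))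
      exact Real.rpow_le_rpow_of_exponent_le hm1 (by linarith)

/-! ### The power saving up to a constant. -/

lemma eMod_eq_stdAddChar {m : ℕ} [NeZero m] (a : ℤ) (x y : ℕ) :
    eMod m (a * recip m x * recip m y) =
      ZMod.stdAddChar ((a : ZMod m) * (x : ZMod m)⁻¹ * (y : ZMod m)⁻¹) := by
  have h : ((a * recip m x * recip m y : ℤ) : ZMod m) =
      (a : ZMod m) * (x : ZMod m)⁻¹ * (y : ZMod m)⁻¹ := by
    simp [recip]
  rw [← h, ZMod.stdAddChar_coe, eMod]

lemma norm_stdAddChar {m : ℕ} [NeZero m] (z : ZMod m) : ‖(ZMod.stdAddChar z : ℂ)‖ = 1 :=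
  AddChar.norm_apply _ _

/-- Removing the parts `X \ A` and `Y \ B` from a bounded double sum. -/
lemma norm_sum_sum_le_add {f : ℕ → ℕ → ℂ} {X Y A B : Finset ℕ} (hA : A ⊆ X) (hB : B ⊆ Y)
    (hf : ∀ x ∈ X, ∀ y ∈ Y, ‖f x y‖ ≤ 1) :
    ‖∑ x ∈ X, ∑ y ∈ Y, f x y‖ ≤
      ‖∑ x ∈ A, ∑ y ∈ B, f x y‖ + #(X \ A) * #Y + #X * #(Y \ B) := by
  have hle : ∀ U ⊆ X, ∀ V ⊆ Y, ‖∑ x ∈ U, ∑ y ∈ V, f x y‖ ≤ #U * #V := fun U hU V hV => by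
    calc ‖∑ x ∈ U, ∑ y ∈ V, f x y‖ ≤ ∑ x ∈ U, ∑ y ∈ V, (1 : ℝ) :=
          (norm_sum_le _ _).trans (sum_le_sum fun x hx => (norm_sum_le _ _).trans
            (sum_le_sum fun y hy => hf x (hU hx) y (hV hy)))
      _ = #U * #V := by simp
  have hsplit : ∑ x ∈ X, ∑ y ∈ Y, f x y = ∑ x ∈ A, ∑ y ∈ B, f x y +
      ∑ x ∈ X \ A, ∑ y ∈ Y, f x y + ∑ x ∈ A, ∑ y ∈ Y \ B, f x y := by
    rw [← sum_sdiff hA]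
    simp_rw [← sum_sdiff hB, sum_add_distrib]
    ring
  rw [hsplit]
  refine (norm_add₃_le).trans ?_
  have h1 := hle (X \ A) sdiff_subset Y subset_rfl
  have h2 := hle A hA (Y \ B) sdiff_subset
  have h3 : (#A : ℝ) * #(Y \ B) ≤ #X * #(Y \ B) := by
    have := card_le_card hA
    gcongr
  linarith

lemma card_filter_sdiff_truncatedUnits_le (m N : ℕ) (η : ℝ) :
    (#({x ∈ Icc 1 N | x.Coprime m} \ truncatedUnits m N η) : ℝ) ≤ N * (m : ℝ) ^ (-η) := by
  have h0 : 0 ≤ (N : ℝ) * (m : ℝ) ^ (-η) := by positivity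
  have : #({x ∈ Icc 1 N | x.Coprime m} \ truncatedUnits m N η) ≤
      #(Icc 1 ⌊(N : ℝ) * (m : ℝ) ^ (-η)⌋₊) := by
    refine card_le_card fun x hx => ?_
    simp only [truncatedUnits, mem_sdiff, mem_filter, mem_Icc, not_and, not_lt] at hx
    exact mem_Icc.mpr ⟨hx.1.1.1, Nat.le_floor (hx.2 hx.1.1 hx.1.2)⟩
  rw [Nat.card_Icc, Nat.add_sub_cancel] at this
  exact (Nat.cast_le.mpr this).trans (Nat.floor_le h0)

/-- The power saving, up to a constant factor. -/
theorem exists_norm_bilinearKloosterman_le {ε : ℝ} (hε : 0 < ε) :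
    ∃ C c : ℝ, 1 ≤ C ∧ 0 < c ∧ ∀ m : ℕ, 2 ≤ m →
      ∀ N₁ N₂ : ℕ, (m : ℝ) ^ ε ≤ (N₁ : ℝ) → (m : ℝ) ^ ε ≤ (N₂ : ℝ) →
        ((N₁ : ℝ) ∉ criticalWindows m ε ∨ (N₂ : ℝ) ∉ criticalWindows m ε) →
      ∀ α₁ α₂ : ℕ → ℂ,
        (∀ x ∈ Icc 1 N₁, ‖α₁ x‖ ≤ 1) → (∀ x ∈ Icc 1 N₂, ‖α₂ x‖ ≤ 1) →
      ∀ a : ℤ, IsCoprime a (m : ℤ) →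
        ‖bilinearKloosterman m a α₁ α₂ N₁ N₂‖ ≤ C * (m : ℝ) ^ (-c) * (N₁ * N₂) := by
  set ε₀ := min ε (1 / 2) with hε₀
  have hε₀pos : 0 < ε₀ := lt_min hε (by norm_num)
  obtain ⟨C, hC1, K, hK1, hmain⟩ := exists_energy_truncatedUnits_le hε
    (η := ε₀ / 8) (by positivity)
  -- Each energy bound loses `m ^ (2η)`, so together they use half of the saving `m ^ (-ε₀)`.
  set η := ε₀ / 8 with hη
  have hK0 : (0 : ℝ) < K := by exact_mod_cast hK1
  -- What remains of `m ^ (-ε₀/2)` after a root of order `2 k₁ k₂ ≤ 2 K ^ 2`.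
  set c := ε₀ / (4 * (K : ℝ) ^ 2) with hc
  have hc0 : 0 < c := by positivity
  -- The summand `2` pays for truncating the two variables.
  refine ⟨C ^ 2 + 2, min c η, by nlinarith, lt_min hc0 (by positivity), ?_⟩
  intro m hm N₁ N₂ hN₁ hN₂ hwin α₁ α₂ hα₁ hα₂ a ha
  have : NeZero m := ⟨by omega⟩
  have hm1 : (1 : ℝ) ≤ m := by exact_mod_cast (by omega : 1 ≤ m)
  have hm0 : (0 : ℝ) < m := by linarith
  obtain ⟨k₁, hk₁, hk₁K, h1, h1'⟩ := hmain m hm N₁ hN₁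
  obtain ⟨k₂, hk₂, hk₂K, h2, h2'⟩ := hmain m hm N₂ hN₂
  set A := truncatedUnits m N₁ η with hA
  set B := truncatedUnits m N₂ η with hB
  set J₁ : ℝ := (energy k₁ A (fun x => (x : ZMod m)⁻¹) : ℝ) with hJ₁
  set J₂ : ℝ := (energy k₂ B (fun x => (x : ZMod m)⁻¹) : ℝ) with hJ₂
  have hJ₁0 : 0 ≤ J₁ := Nat.cast_nonneg _
  have hJ₂0 : 0 ≤ J₂ := Nat.cast_nonneg _
  have hunit : IsUnit (a : ZMod m) := (ZMod.coe_int_isUnit_iff_isCoprime a m).mpr ha.symm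
  have hsubA : A ⊆ {x ∈ Icc 1 N₁ | x.Coprime m} := fun x hx => by
    simp only [hA, truncatedUnits, mem_filter] at hx ⊢
    exact ⟨hx.1, hx.2.1⟩
  have hsubB : B ⊆ {x ∈ Icc 1 N₂ | x.Coprime m} := fun x hx => by
    simp only [hB, truncatedUnits, mem_filter] at hx ⊢
    exact ⟨hx.1, hx.2.1⟩
  have hX : ∀ N : ℕ, (#{x ∈ Icc 1 N | x.Coprime m} : ℝ) ≤ N := fun N => by
    have := card_le_card (filter_subset (fun x => x.Coprime m) (Icc 1 N))
    rw [Nat.card_Icc, Nat.add_sub_cancel] at this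
    exact_mod_cast this
  have hAN : (#A : ℝ) ≤ N₁ := (Nat.cast_le.mpr (card_le_card hsubA)).trans (hX N₁)
  have hBN : (#B : ℝ) ≤ N₂ := (Nat.cast_le.mpr (card_le_card hsubB)).trans (hX N₂)
  have hprod : m * J₁ * J₂ ≤
      C ^ 2 * (m : ℝ) ^ (-(ε₀ / 2)) * ((N₁ : ℝ) ^ (2 * k₁) * (N₂ : ℝ) ^ (2 * k₂)) := by
    have hmm : (m : ℝ) = (m : ℝ) ^ (1 / 2 : ℝ) * (m : ℝ) ^ (1 / 2 : ℝ) := by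
      rw [← Real.rpow_add hm0]
      norm_num
    have hexp : (m : ℝ) ^ (-(ε₀ / 2)) = (m : ℝ) ^ (2 * η) * (m : ℝ) ^ (2 * η) *
        (m : ℝ) ^ (-ε₀) := by
      rw [← Real.rpow_add hm0, ← Real.rpow_add hm0]
      congr 1
      rw [hη]
      ring
    have hreg : m * J₁ * J₂ = ((m : ℝ) ^ (1 / 2 : ℝ) * J₁) * ((m : ℝ) ^ (1 / 2 : ℝ) * J₂) := by
      conv_lhs => rw [hmm]
      ring
    rw [hreg, hexp]
    rcases hwin with h | h
    · refine (mul_le_mul (h1' h) h2 (by positivity) (by positivity)).trans_eq ?_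
      ring
    · refine (mul_le_mul h1 (h2' h) (by positivity) (by positivity)).trans_eq ?_
      ring
  set S := ∑ x ∈ A, ∑ y ∈ B, α₁ x * α₂ y *
    ZMod.stdAddChar ((a : ZMod m) * (x : ZMod m)⁻¹ * (y : ZMod m)⁻¹) with hS
  have hSpow : ‖S‖ ^ (2 * k₁ * k₂) ≤ (N₁ * N₂ * (C ^ 2 * (m : ℝ) ^ (-c))) ^ (2 * k₁ * k₂) := by
    have hle := norm_bilinear_pow_le hk₁ hk₂ A B α₁ α₂
      (fun x hx => hα₁ x (mem_filter.mp (hsubA hx)).1)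
      (fun x hx => hα₂ x (mem_filter.mp (hsubB hx)).1) (a : ZMod m) hunit
    refine hle.trans ?_
    calc (#A : ℝ) ^ (2 * k₁ * (k₂ - 1)) * (#B : ℝ) ^ (2 * k₂ * (k₁ - 1)) * (m * J₁ * J₂)
        ≤ (N₁ : ℝ) ^ (2 * k₁ * (k₂ - 1)) * (N₂ : ℝ) ^ (2 * k₂ * (k₁ - 1)) *
          (C ^ 2 * (m : ℝ) ^ (-(ε₀ / 2)) * ((N₁ : ℝ) ^ (2 * k₁) * (N₂ : ℝ) ^ (2 * k₂))) := by
          gcongr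
      _ = (N₁ * N₂ : ℝ) ^ (2 * k₁ * k₂) * (C ^ 2 * (m : ℝ) ^ (-(ε₀ / 2))) := by
          obtain ⟨p, rfl⟩ : ∃ p, k₁ = p + 1 := ⟨k₁ - 1, by omega⟩
          obtain ⟨q, rfl⟩ : ∃ q, k₂ = q + 1 := ⟨k₂ - 1, by omega⟩
          simp only [Nat.add_sub_cancel]
          ring
      _ ≤ (N₁ * N₂ : ℝ) ^ (2 * k₁ * k₂) * (C ^ 2 * (m : ℝ) ^ (-c)) ^ (2 * k₁ * k₂) := by
          rw [mul_pow (C ^ 2)]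
          have hC2 : 1 ≤ C ^ 2 := one_le_pow₀ hC1
          have hkk : 2 * k₁ * k₂ ≠ 0 := by positivity
          have hpow : (m : ℝ) ^ (-(ε₀ / 2)) ≤ ((m : ℝ) ^ (-c)) ^ (2 * k₁ * k₂) := by
            rw [← Real.rpow_natCast, ← Real.rpow_mul hm0.le]
            refine Real.rpow_le_rpow_of_exponent_le hm1 ?_
            have hkk' : ((2 * k₁ * k₂ : ℕ) : ℝ) ≤ 2 * (K : ℝ) ^ 2 := by
              have : 2 * k₁ * k₂ ≤ 2 * K ^ 2 := by
                rw [sq, mul_assoc]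
                gcongr
              exact_mod_cast this
            have : c * (2 * (K : ℝ) ^ 2) = ε₀ / 2 := by
              rw [hc]
              field_simp
              norm_num
            nlinarith
          have := le_self_pow₀ hC2 hkk
          gcongr
      _ = _ := (mul_pow _ _ _).symm
  have hSle : ‖S‖ ≤ N₁ * N₂ * (C ^ 2 * (m : ℝ) ^ (-c)) :=
    le_of_pow_le_pow_left₀ (by positivity) (by positivity) hSpow
  have hbil : bilinearKloosterman m a α₁ α₂ N₁ N₂ =
      ∑ x ∈ Icc 1 N₁ with x.Coprime m, ∑ y ∈ Icc 1 N₂ with y.Coprime m, α₁ x * α₂ y *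
        ZMod.stdAddChar ((a : ZMod m) * (x : ZMod m)⁻¹ * (y : ZMod m)⁻¹) := by
    simp_rw [bilinearKloosterman, eMod_eq_stdAddChar]
  have hfull := norm_sum_sum_le_add hsubA hsubB (f := fun x y => α₁ x * α₂ y *
        ZMod.stdAddChar ((a : ZMod m) * (x : ZMod m)⁻¹ * (y : ZMod m)⁻¹)) fun x hx y hy => by
    rw [norm_mul, norm_mul, norm_stdAddChar, mul_one]
    exact mul_le_one₀ (hα₁ x (mem_filter.mp hx).1) (norm_nonneg _) (hα₂ y (mem_filter.mp hy).1)
  rw [hbil]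
  refine hfull.trans ?_
  have hd1 := card_filter_sdiff_truncatedUnits_le m N₁ η
  have hd2 := card_filter_sdiff_truncatedUnits_le m N₂ η
  have hcm : (m : ℝ) ^ (-c) ≤ (m : ℝ) ^ (-min c η) :=
    Real.rpow_le_rpow_of_exponent_le hm1 (neg_le_neg (min_le_left _ _))
  have hηm : (m : ℝ) ^ (-η) ≤ (m : ℝ) ^ (-min c η) :=
    Real.rpow_le_rpow_of_exponent_le hm1 (neg_le_neg (min_le_right _ _))
  calc _ ≤ N₁ * N₂ * (C ^ 2 * (m : ℝ) ^ (-c)) + (N₁ * (m : ℝ) ^ (-η)) * N₂ +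
        N₁ * (N₂ * (m : ℝ) ^ (-η)) := by
        have := hX N₁
        have := hX N₂
        gcongr
    _ ≤ N₁ * N₂ * (C ^ 2 * (m : ℝ) ^ (-min c η)) + (N₁ * (m : ℝ) ^ (-min c η)) * N₂ +
        N₁ * (N₂ * (m : ℝ) ^ (-min c η)) := by gcongr
    _ = _ := by ring

/-! ### A constant saving for a fixed modulus. -/

/-- Two sums `b₁ + b₂ w`, `b₁ + b₂ w'` cannot both be large unless `w` and `w'` are close. -/
lemma sq_norm_add_norm_le {b₁ b₂ w w' : ℂ} (h1 : ‖b₁‖ ≤ 1) (h2 : ‖b₂‖ ≤ 1) (hw : ‖w‖ = 1)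
    (hw' : ‖w'‖ = 1) :
    (‖b₁ + b₂ * w‖ + ‖b₁ + b₂ * w'‖) ^ 2 ≤ 8 + 4 * ‖w + w'‖ := by
  have hexp : ∀ u : ℂ, ‖u‖ = 1 →
      ‖b₁ + b₂ * u‖ ^ 2 ≤ 2 + 2 * (b₁ * (starRingEnd ℂ) (b₂ * u)).re := by
    intro u hu
    rw [← Complex.normSq_eq_norm_sq, Complex.normSq_add, Complex.normSq_eq_norm_sq,
      Complex.normSq_eq_norm_sq, norm_mul, hu, mul_one]
    have := pow_le_one₀ (n := 2) (norm_nonneg _) h1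
    have := pow_le_one₀ (n := 2) (norm_nonneg _) h2
    linarith
  have hre : (b₁ * (starRingEnd ℂ) (b₂ * w)).re + (b₁ * (starRingEnd ℂ) (b₂ * w')).re ≤
      ‖w + w'‖ := by
    rw [← Complex.add_re, ← mul_add, ← map_add, ← mul_add]
    refine (Complex.re_le_norm _).trans ?_
    rw [norm_mul, Complex.norm_conj, norm_mul, ← mul_assoc]
    exact mul_le_of_le_one_left (norm_nonneg _) (mul_le_one₀ h1 (norm_nonneg _) h2)
  have := hexp w hw
  have := hexp w' hw'
  nlinarith [sq_nonneg (‖b₁ + b₂ * w‖ - ‖b₁ + b₂ * w'‖)]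

lemma norm_add_lt_two {w w' : ℂ} (hw : ‖w‖ = 1) (hw' : ‖w'‖ = 1) (hne : w ≠ w') :
    ‖w + w'‖ < 2 := by
  have h := parallelogram_law_with_norm ℝ w w'
  have : 0 < ‖w - w'‖ := norm_pos_iff.mpr (sub_ne_zero.mpr hne)
  rw [hw, hw'] at h
  nlinarith [norm_nonneg (w + w')]

/-- Finiteness of `ZMod m` makes the strict inequality uniform. -/
lemma exists_norm_stdAddChar_add_le {m : ℕ} [NeZero m] (hm : 2 ≤ m) :
    ∃ τ < 2, ∀ u v : ZMod m, u ≠ v →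
      ‖(ZMod.stdAddChar u : ℂ) + ZMod.stdAddChar v‖ ≤ τ := by
  have : Fact (1 < m) := ⟨hm⟩
  obtain ⟨p, hp, hmax⟩ := exists_max_image {p : ZMod m × ZMod m | p.1 ≠ p.2}
    (fun p => ‖(ZMod.stdAddChar p.1 : ℂ) + ZMod.stdAddChar p.2‖) ⟨(0, 1), by simp⟩
  refine ⟨_, norm_add_lt_two (norm_stdAddChar p.1) (norm_stdAddChar p.2)
    (ZMod.injective_stdAddChar.ne (mem_filter.mp hp).2), fun u v huv => ?_⟩
  exact hmax (u, v) (by simpa using huv)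

/-- A saving in every `2 × 2` block with rows and columns congruent to `1, 2` modulo `m`. -/
lemma exists_block_saving {m : ℕ} [NeZero m] (hm : 2 ≤ m) :
    ∃ c : ℝ, 0 < c ∧ ∀ (a : ZMod m) (_ : IsUnit a) (α₁ α₂ β₁ β₂ : ℂ),
      ‖α₁‖ ≤ 1 → ‖α₂‖ ≤ 1 → ‖β₁‖ ≤ 1 → ‖β₂‖ ≤ 1 → IsUnit (2 : ZMod m) →
      ‖α₁ * β₁ * ZMod.stdAddChar a + α₁ * β₂ * ZMod.stdAddChar (a * (2 : ZMod m)⁻¹) +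
        (α₂ * β₁ * ZMod.stdAddChar (a * (2 : ZMod m)⁻¹) +
          α₂ * β₂ * ZMod.stdAddChar (a * (2 : ZMod m)⁻¹ * (2 : ZMod m)⁻¹))‖ ≤ 4 - c := by
  have : Fact (1 < m) := ⟨hm⟩
  obtain ⟨τ, hτ, hle⟩ := exists_norm_stdAddChar_add_le hm
  have hτ0 : 0 ≤ τ := (norm_nonneg _).trans (hle 0 1 zero_ne_one)
  refine ⟨4 - √(8 + 4 * τ), ?_, ?_⟩
  · rw [sub_pos, Real.sqrt_lt' (by norm_num)]
    linarith
  intro a ha α₁ α₂ β₁ β₂ h1 h2 h3 h4 hu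
  rw [sub_sub_cancel]
  set h : ZMod m := (2 : ZMod m)⁻¹ with hh
  have h2h : 2 * h = 1 := ZMod.mul_inv_of_unit 2 hu
  set w : ℂ := ZMod.stdAddChar (a * h - a) with hw
  set w' : ℂ := ZMod.stdAddChar (a * h * h - a * h) with hw'
  -- The phase steps in the two rows differ by `a (h - 1) ^ 2`, and `4 (h - 1) ^ 2 = 1`.
  have hne : a * h - a ≠ a * h * h - a * h := by
    intro heq
    have h5 : a * (h - 1) ^ 2 = 0 := by linear_combination -heq
    rw [ha.mul_right_eq_zero] at h5
    have h6 : (1 : ZMod m) = 0 := by linear_combination 4 * h5 + (3 - 2 * h) * h2h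
    exact one_ne_zero h6
  have hψ1 : (ZMod.stdAddChar (a * h) : ℂ) = ZMod.stdAddChar a * w := by
    rw [hw, ← AddChar.map_add_eq_mul]
    congr 1
    ring
  have hψ2 : (ZMod.stdAddChar (a * h * h) : ℂ) = ZMod.stdAddChar (a * h) * w' := by
    rw [hw', ← AddChar.map_add_eq_mul]
    congr 1
    ring
  have e1 : α₁ * β₁ * ZMod.stdAddChar a + α₁ * β₂ * ZMod.stdAddChar (a * h) =
      α₁ * ZMod.stdAddChar a * (β₁ + β₂ * w) := by
    rw [hψ1]
    ring
  have e2 : α₂ * β₁ * ZMod.stdAddChar (a * h) + α₂ * β₂ * ZMod.stdAddChar (a * h * h) =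
      α₂ * ZMod.stdAddChar (a * h) * (β₁ + β₂ * w') := by
    rw [hψ2]
    ring
  rw [e1, e2]
  refine (norm_add_le _ _).trans ?_
  rw [norm_mul, norm_mul, norm_mul, norm_mul, norm_stdAddChar, norm_stdAddChar, mul_one, mul_one]
  refine (add_le_add (mul_le_of_le_one_left (norm_nonneg _) h1)
    (mul_le_of_le_one_left (norm_nonneg _) h2)).trans ?_
  refine Real.le_sqrt_of_sq_le ((sq_norm_add_norm_le h3 h4 (norm_stdAddChar _)
    (norm_stdAddChar _)).trans ?_)
  have := hle _ _ hne
  linarith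

/-- A double sum with a saving `c` in each of the blocks `(1 + m t₁, 2 + m t₁) × (1 + m t₂,
2 + m t₂)` has a proportional total saving. -/
lemma norm_sum_sum_le_of_block_saving {m N₁ N₂ : ℕ} (hm : 2 ≤ m) (hN₁ : 2 ≤ N₁) (hN₂ : 2 ≤ N₂)
    {c : ℝ} (hc : 0 ≤ c) (f : ℕ → ℕ → ℂ)
    (hf : ∀ x ∈ Icc 1 N₁, ∀ y ∈ Icc 1 N₂, ‖f x y‖ ≤ 1)
    (hblock : ∀ s t : ℕ, 2 + m * s ≤ N₁ → 2 + m * t ≤ N₂ →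
      ‖f (1 + m * s) (1 + m * t) + f (1 + m * s) (2 + m * t) +
        (f (2 + m * s) (1 + m * t) + f (2 + m * s) (2 + m * t))‖ ≤ 4 - c) :
    ‖∑ x ∈ Icc 1 N₁, ∑ y ∈ Icc 1 N₂, f x y‖ ≤ (1 - c / (m + 1) ^ 2) * (N₁ * N₂) := by
  let U : ℕ → Finset ℕ := fun t => {1 + m * t, 2 + m * t}
  -- The number of pairs `1 + m t, 2 + m t` inside `[1, N]`; then `N ≤ m * T N + 1 ≤ (m + 1) * T N`.
  set T : ℕ → ℕ := fun N => (N - 2) / m + 1 with hT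
  have hTle : ∀ N, 2 ≤ N → ∀ t ∈ range (T N), 2 + m * t ≤ N := fun N hN t ht => by
    have h1 : t ≤ (N - 2) / m := by simpa [hT, Nat.lt_succ_iff] using ht
    have h2 := Nat.mul_le_mul_left m h1
    have h3 := Nat.mul_div_le (N - 2) m
    omega
  have hNT : ∀ N : ℕ, 2 ≤ N → (N : ℝ) ≤ (m + 1) * T N := fun N hN => by
    have h1 := Nat.lt_mul_div_succ (N - 2) (by omega : 0 < m)
    have h2 : N ≤ (m + 1) * T N := by
      simp only [hT]
      rw [add_mul]
      generalize (N - 2) / m = q at h1 ⊢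
      omega
    exact_mod_cast h2
  have hUdisj : ∀ s t : ℕ, s ≠ t → Disjoint (U s) (U t) := by
    intro s t hst
    refine disjoint_left.mpr fun x hxs hxt => hst ?_
    simp only [U, mem_insert, mem_singleton] at hxs hxt
    have hdiv : ∀ t, x = 1 + m * t ∨ x = 2 + m * t → (x - 1) / m = t := by
      rintro t (rfl | rfl)
      · rw [Nat.add_sub_cancel_left, Nat.mul_div_cancel_left _ (by omega)]
      · rw [show 2 + m * t - 1 = 1 + m * t by omega, Nat.add_mul_div_left _ _ (by omega),
          Nat.div_eq_of_lt (by omega), zero_add]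
    exact (hdiv s hxs).symm.trans (hdiv t hxt)
  set I := range (T N₁) ×ˢ range (T N₂) with hI
  set V := I.biUnion fun p => U p.1 ×ˢ U p.2 with hV
  have hVdisj : (I : Set (ℕ × ℕ)).PairwiseDisjoint fun p => U p.1 ×ˢ U p.2 := by
    intro p _ q _ hpq
    rw [Function.onFun, disjoint_product]
    by_cases h : p.1 = q.1
    · exact Or.inr (hUdisj _ _ fun h' => hpq (Prod.ext h h'))
    · exact Or.inl (hUdisj _ _ h)
  have hVsub : V ⊆ Icc 1 N₁ ×ˢ Icc 1 N₂ := by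
    intro z hz
    simp only [hV, hI, U, mem_biUnion, mem_product, mem_insert, mem_singleton] at hz
    obtain ⟨p, ⟨hp1, hp2⟩, hz1, hz2⟩ := hz
    have := hTle N₁ hN₁ _ hp1
    have := hTle N₂ hN₂ _ hp2
    simp only [mem_product, mem_Icc]
    omega
  have hUcard : ∀ t, #(U t) = 2 := fun t => card_pair (by omega)
  have hVcard : #V = 4 * #I := by
    rw [hV, card_biUnion hVdisj]
    simp [card_product, hUcard, mul_comm]
  have hIcard : (#I : ℝ) = T N₁ * T N₂ := by simp [hI, card_product]
  have hrest : ‖∑ z ∈ (Icc 1 N₁ ×ˢ Icc 1 N₂) \ V, f z.1 z.2‖ ≤ (N₁ : ℝ) * N₂ - 4 * #I := by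
    calc ‖∑ z ∈ (Icc 1 N₁ ×ˢ Icc 1 N₂) \ V, f z.1 z.2‖
        ≤ ∑ z ∈ (Icc 1 N₁ ×ˢ Icc 1 N₂) \ V, (1 : ℝ) := by
          refine (norm_sum_le _ _).trans (sum_le_sum fun z hz => ?_)
          have := mem_product.mp (mem_sdiff.mp hz).1
          exact hf _ this.1 _ this.2
      _ = _ := by
          rw [sum_const, nsmul_eq_mul, mul_one, card_sdiff_of_subset hVsub,
            Nat.cast_sub (card_le_card hVsub), hVcard, card_product]
          simp
  have hVsum : ‖∑ z ∈ V, f z.1 z.2‖ ≤ #I * (4 - c) := by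
    rw [hV, sum_biUnion hVdisj, ← nsmul_eq_mul, ← sum_const]
    refine (norm_sum_le _ _).trans (sum_le_sum fun p hp => ?_)
    rw [hI, mem_product] at hp
    rw [sum_product, sum_pair (by omega), sum_pair (by omega), sum_pair (by omega)]
    exact hblock _ _ (hTle N₁ hN₁ _ hp.1) (hTle N₂ hN₂ _ hp.2)
  rw [← sum_product', ← sum_sdiff hVsub]
  refine (norm_add_le _ _).trans ((add_le_add hrest hVsum).trans ?_)
  have hprod : (N₁ : ℝ) * N₂ ≤ (m + 1) ^ 2 * #I := by
    calc (N₁ : ℝ) * N₂ ≤ ((m + 1) * T N₁) * ((m + 1) * T N₂) :=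
          mul_le_mul (hNT _ hN₁) (hNT _ hN₂) (by positivity) (by positivity)
      _ = _ := by rw [hIcard]; ring
  have : c / (m + 1) ^ 2 * (N₁ * N₂) ≤ c * #I := by
    rw [div_mul_eq_mul_div, div_le_iff₀ (by positivity)]
    calc c * (N₁ * N₂ : ℝ) ≤ c * ((m + 1) ^ 2 * #I) := by gcongr
      _ = _ := by ring
  linarith

/-- For a fixed modulus the trivial bound is improved by a constant factor. -/
theorem exists_norm_bilinearKloosterman_le_of_fixed_modulus {m : ℕ} (hm : 2 ≤ m) :
    ∃ c : ℝ, 0 < c ∧ ∀ N₁ N₂ : ℕ, 2 ≤ N₁ → 2 ≤ N₂ → ∀ α₁ α₂ : ℕ → ℂ,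
        (∀ x ∈ Icc 1 N₁, ‖α₁ x‖ ≤ 1) → (∀ x ∈ Icc 1 N₂, ‖α₂ x‖ ≤ 1) →
      ∀ a : ℤ, IsCoprime a (m : ℤ) →
        ‖bilinearKloosterman m a α₁ α₂ N₁ N₂‖ ≤ (1 - c) * (N₁ * N₂) := by
  have : NeZero m := ⟨by omega⟩
  obtain ⟨c, hc, hblock⟩ := exists_block_saving hm
  -- The cap `1` serves even `m`, where three of the four entries of a block vanish.
  refine ⟨min c 1 / (m + 1) ^ 2, by positivity, fun N₁ N₂ hN₁ hN₂ α₁ α₂ hα₁ hα₂ a ha => ?_⟩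
  have hunit : IsUnit (a : ZMod m) := (ZMod.coe_int_isUnit_iff_isCoprime a m).mpr ha.symm
  let F : ℕ → ℕ → ℂ := fun x y => α₁ x * α₂ y *
    ZMod.stdAddChar ((a : ZMod m) * (x : ZMod m)⁻¹ * (y : ZMod m)⁻¹)
  have hF : ∀ x ∈ Icc 1 N₁, ∀ y ∈ Icc 1 N₂, ‖F x y‖ ≤ 1 := fun x hx y hy => by
    simp only [F]
    rw [norm_mul, norm_mul, norm_stdAddChar, mul_one]
    exact mul_le_one₀ (hα₁ x hx) (norm_nonneg _) (hα₂ y hy)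
  have hbil : bilinearKloosterman m a α₁ α₂ N₁ N₂ = ∑ x ∈ Icc 1 N₁, ∑ y ∈ Icc 1 N₂,
      if x.Coprime m then if y.Coprime m then F x y else 0 else 0 := by
    simp_rw [bilinearKloosterman, eMod_eq_stdAddChar, sum_filter, F]
    refine sum_congr rfl fun x _ => ?_
    split_ifs <;> simp
  rw [hbil]
  refine norm_sum_sum_le_of_block_saving hm hN₁ hN₂ (by positivity)
    (fun x y => if x.Coprime m then if y.Coprime m then F x y else 0 else 0)
    (fun x hx y hy => ?_) ?_
  · split_ifs
    · exact hF x hx y hy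
    · simp
    · simp
  intro s t hs ht
  have hcop1 : ∀ s, (1 + m * s).Coprime m ↔ True := by simp
  have hcop2 : ∀ s, (2 + m * s).Coprime m ↔ Nat.Coprime 2 m := by simp
  simp only [hcop1, hcop2, if_true]
  have m1 : 1 + m * s ∈ Icc 1 N₁ := mem_Icc.mpr (by omega)
  have m2 : 2 + m * s ∈ Icc 1 N₁ := mem_Icc.mpr (by omega)
  have m3 : 1 + m * t ∈ Icc 1 N₂ := mem_Icc.mpr (by omega)
  have m4 : 2 + m * t ∈ Icc 1 N₂ := mem_Icc.mpr (by omega)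
  by_cases h2 : Nat.Coprime 2 m
  · simp only [if_pos h2]
    have hu : IsUnit (2 : ZMod m) := by
      have := (ZMod.isUnit_iff_coprime 2 m).mpr h2
      exact_mod_cast this
    have := hblock a hunit _ _ _ _ (hα₁ _ m1) (hα₁ _ m2) (hα₂ _ m3) (hα₂ _ m4) hu
    simp only [F]
    push_cast
    simp only [CharP.cast_eq_zero, zero_mul, add_zero, ZMod.inv_one, mul_one]
    exact this.trans (sub_le_sub_left (min_le_left c 1) 4)
  · simp only [if_neg h2, add_zero]
    exact (hF _ m1 _ m3).trans (by linarith [min_le_right c (1 : ℝ)])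

/-! ### Combining large and small moduli. -/

theorem corollary1 (ε : ℝ) (hε : 0 < ε) :
    ∃ δ : ℝ, 0 < δ ∧
      ∀ m : ℕ, 2 ≤ m →
      ∀ N₁ N₂ : ℕ, (m : ℝ) ^ ε ≤ (N₁ : ℝ) → (m : ℝ) ^ ε ≤ (N₂ : ℝ) →
        ((N₁ : ℝ) ∉ criticalWindows m ε ∨ (N₂ : ℝ) ∉ criticalWindows m ε) →
      ∀ α₁ α₂ : ℕ → ℂ,
        (∀ x ∈ Finset.Icc 1 N₁, ‖α₁ x‖ ≤ 1) → (∀ x ∈ Finset.Icc 1 N₂, ‖α₂ x‖ ≤ 1) →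
      ∀ a : ℤ, IsCoprime a (m : ℤ) →
        ‖bilinearKloosterman m a α₁ α₂ N₁ N₂‖ < (m : ℝ) ^ (-δ) * (N₁ : ℝ) * (N₂ : ℝ) := by
  obtain ⟨C, c, hC1, hc0, hlarge⟩ := exists_norm_bilinearKloosterman_le hε
  have hsmall : ∀ m : ℕ, ∃ d : ℝ, 0 < d ∧ (2 ≤ m → ∀ N₁ N₂ : ℕ, 2 ≤ N₁ → 2 ≤ N₂ →
      ∀ α₁ α₂ : ℕ → ℂ, (∀ x ∈ Icc 1 N₁, ‖α₁ x‖ ≤ 1) → (∀ x ∈ Icc 1 N₂, ‖α₂ x‖ ≤ 1) →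
      ∀ a : ℤ, IsCoprime a (m : ℤ) →
        ‖bilinearKloosterman m a α₁ α₂ N₁ N₂‖ ≤ (1 - d) * (N₁ * N₂)) := fun m => by
    by_cases hm : 2 ≤ m
    · obtain ⟨d, hd, h⟩ := exists_norm_bilinearKloosterman_le_of_fixed_modulus hm
      exact ⟨d, hd, fun _ => h⟩
    · exact ⟨1, one_pos, fun h => absurd h hm⟩
  choose d hd0 hd using hsmall
  -- From `m₀` on, half of the exponent absorbs `C`.
  obtain ⟨m₀, hm₀⟩ : ∃ m₀ : ℕ, ∀ m : ℕ, m₀ ≤ m → C < (m : ℝ) ^ (c / 2) :=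
    Filter.eventually_atTop.mp (((tendsto_rpow_atTop (by positivity)).comp
      tendsto_natCast_atTop_atTop).eventually_gt_atTop C)
  -- The exponent `d m / (m + 1)` is small enough because `log m < m + 1` gives `1 - d m < m ^ (-d m
  -- / (m + 1))`.
  obtain ⟨M, -, hMmin⟩ := exists_min_image (range (m₀ + 1)) (fun m => d m / (m + 1))
    ⟨0, by simp⟩
  refine ⟨min (c / 2) (d M / (M + 1)), lt_min (by positivity) (div_pos (hd0 M) (by positivity)),
    ?_⟩
  intro m hm N₁ N₂ hN₁ hN₂ hwin α₁ α₂ hα₁ hα₂ a ha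
  have hm1 : (1 : ℝ) < m := by exact_mod_cast (by omega : 1 < m)
  have hm0 : (0 : ℝ) < m := by linarith
  have htwo : ∀ N : ℕ, (m : ℝ) ^ ε ≤ N → 2 ≤ N := fun N hN => by
    have : (1 : ℝ) < N := (Real.one_lt_rpow hm1 hε).trans_le hN
    exact_mod_cast this
  have h1 := htwo N₁ hN₁
  have h2 := htwo N₂ hN₂
  have hNN : (0 : ℝ) < N₁ * N₂ := by
    have : 0 < N₁ * N₂ := by positivity
    exact_mod_cast this
  rw [mul_assoc]
  rcases Nat.lt_or_ge m m₀ with h | h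
  · refine (hd m hm N₁ N₂ h1 h2 α₁ α₂ hα₁ hα₂ a ha).trans_lt (mul_lt_mul_of_pos_right ?_ hNN)
    have hle := hMmin m (mem_range.mpr (by omega))
    have hmono : (m : ℝ) ^ (-(d m / (m + 1))) ≤ (m : ℝ) ^ (-min (c / 2) (d M / (M + 1))) :=
      Real.rpow_le_rpow_of_exponent_le hm1.le (neg_le_neg ((min_le_right _ _).trans hle))
    refine lt_of_lt_of_le ?_ hmono
    rw [Real.rpow_def_of_pos hm0]
    have hexp := Real.add_one_le_exp (Real.log m * -(d m / (m + 1)))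
    have hlog : Real.log m < m + 1 := by linarith [Real.log_le_sub_one_of_pos hm0]
    have : Real.log m * (d m / (m + 1)) < d m := by
      rw [← mul_div_assoc, div_lt_iff₀ (by positivity), mul_comm]
      exact mul_lt_mul_of_pos_left hlog (hd0 m)
    linarith
  · refine (hlarge m hm N₁ N₂ hN₁ hN₂ hwin α₁ α₂ hα₁ hα₂ a ha).trans_lt
      (mul_lt_mul_of_pos_right ?_ hNN)
    calc C * (m : ℝ) ^ (-c) < (m : ℝ) ^ (c / 2) * (m : ℝ) ^ (-c) := by
          gcongr
          exact hm₀ m h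
      _ = (m : ℝ) ^ (-(c / 2)) := by
          rw [← Real.rpow_add hm0]
          congr 1
          ring
      _ ≤ _ := Real.rpow_le_rpow_of_exponent_le hm1.le (neg_le_neg (min_le_left _ _))
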